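/- **Protocols.** A protocol $\tau$ is a finite directed acyclic graph with a nonempty set $\mathrm{Vars}(\tau)$ of nodes of in-degree $0$, the variables; the other nodes are query nodes. A protocol is *flat*, written $\tau=g(f_1(\vec x_1),\dots,f_n(\vec x_n))$, if it has a root $g$ (a unique node without outgoing edges), its longest directed path has length $2$, and every edge leads either from a variable in $\vec x_i$ to the query node $f_i$ or from some $f_i$ to $g$ (so no variable is a direct input of $g$). The node $f_i$ has a *private variable* if some variable occurs in $\vec x_i$ but in no $\vec x_j$ with $j\neq i$. **Runs.** A local session (user) is a map $I\colon \mathrm{Vars}(\tau)\to\{0,1\}$. A global session $(S,\sigma)$ consists of a nonempty finite multiset $S=\{I_1,\dots,I_m\}$ of local sessions and a schedule $\sigma$, i.e. a list containing each pair $(i,f)$ with $1\le i\le m$ and $f$ a query node exactly once, such that $(i,f)$ precedes $(i,f')$ whenever $f\to f'$ is an edge between query nodes. In each situation the adversary chooses one of three actions: *wait*, upon which the next scheduled pair $(i,f)$ is performed, that is, the query consisting of $f$ and the current values of user $i$ at the predecessors of $f$ is recorded; *reply* to a recorded, not yet answered query with a bit, which then becomes the value of the querying user at the queried node; or *print* a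 partial assignment of bits to the nodes, which ends the run. Otherwise the run ends when the schedule is exhausted and all queries are answered; in that last situation the adversary may still print. *Wait* is available only if a query remains and the next scheduled user already has values at all predecessors of the next scheduled node. A strategy is a function that chooses the action depending only on the number $m$ of users and the sequence of recorded queries, each with its node, its arguments, and its reply together with the time of the reply (the number of actions performed up to and including it), but without the identity of the querying user and without the remaining schedule; in its own runs it may choose available actions only. The protocol is *insecure* (against active linking attacks) if there is a strategy that, in the run for every global session $(S,\sigma)$, prints some $I\in S$. **Tracking strategies.** A set $T$ of query nodes of $\tau$ is a *tracking strategy* for $\tau$ if there is some $t_{init}\in T$ from which every $u\in T$ is reachable by a directed path (possibly of length $0$), and if for each variable $x$ there is a directed path $p_x$ from $x$ to some element of $T$ such that for $x\ne y$ the paths $p_x$ and $p_y$ share no node outside $T$. **Theorem.** Let $\tau=g(f_1(\vec x_1),\dots,f_n(\vec x_n))$ be a flat protocol in which every $f_i$ has a private variable. Then $\tau$ is insecure if and only if there is a tracking strategy for $\tau$. -/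

import Mathlib

noncomputable section

namespace Linking

/-- A protocol on the node type `N`: a directed acyclic graph with a nonempty set of variable
nodes (user input values), each of which has in-degree `0`. The other nodes are query nodes. -/
structure Protocol (N : Type*) extends Digraph N where
  acyclic : ∀ v, ¬ Relation.TransGen Adj v v
  vars : Set N
  vars_nonempty : vars.Nonempty
  vars_source : ∀ u, ∀ x ∈ vars, ¬ Adj u x

/-- A partial assignment of Boolean values to the nodes (`none` means undefined). -/
abbrev Assign (N : Type*) := N → Option Bool

/-- One query as it is recorded in a protocol state: the queried node, the arguments (the user's
values at the predecessors of the node), the index of the querying user, and the adversary's reply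
together with the time of the reply (`none` for a query that is still unanswered). -/
structure Entry (N : Type*) (n : ℕ) where
  node : N
  args : Assign N
  user : Fin n
  reply : Option (Bool × ℕ)

/-- A query as the adversary sees it: without the index of the querying user. -/
structure ViewEntry (N : Type*) where
  node : N
  args : Assign N
  reply : Option (Bool × ℕ)

/-- What the adversary sees: the number of users and the sequence of queries made so far. -/
structure View (N : Type*) where
  numUsers : ℕ
  queries : List (ViewEntry N)

/-- The adversary's actions: wait for the next query, reply to the `k`-th query (counted from `0`)
with the bit `r`, or print a partial assignment. -/
inductive Action (N : Type*) where
  | wait : Action N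
  | reply (k : ℕ) (r : Bool) : Action N
  | print (I : Assign N) : Action N

/-- A strategy chooses an action on the basis of the adversary's view only. -/
abbrev Strategy (N : Type*) := View N → Action N

/-- The state of a run with `n` users: the current (partial) assignments of the users, the
sequence of queries made so far, the queries that are still to be performed, and the number of
actions performed so far. -/
structure State (N : Type*) (n : ℕ) where
  mem : Fin n → Assign N
  log : List (Entry N n)
  rest : List (Fin n × N)
  time : ℕ

/-- The view of a state: user indices, the remaining schedule and the users' memory are hidden. -/
def State.view {N : Type*} {n : ℕ} (s : State N n) : View N where
  numUsers := n
  queries := s.log.map fun e => ⟨e.node, e.args, e.reply⟩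

/-- The run is over: nothing is left to be scheduled and all queries have been answered. -/
def State.Final {N : Type*} {n : ℕ} (s : State N n) : Prop :=
  s.rest = [] ∧ ∀ e ∈ s.log, e.reply ≠ none

namespace Protocol

variable {N : Type*} (τ : Protocol N)

/-- A user's local session: Boolean values for the variables of the protocol. -/
abbrev LocalSession := τ.vars → Bool

open scoped Classical in
/-- A local session, as a partial assignment defined exactly on the variables. -/
def toAssign (I : τ.LocalSession) : Assign N :=
  fun u => if h : u ∈ τ.vars then some (I ⟨u, h⟩) else none

/-- `n`-user schedules: every pair of a user and a query node appears exactly once, and each user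
queries `f` before `g` if `f → g` is an edge between query nodes. -/
structure IsSchedule (n : ℕ) (σ : List (Fin n × N)) : Prop where
  nodup : σ.Nodup
  mem_iff : ∀ i f, (i, f) ∈ σ ↔ f ∉ τ.vars
  order : ∀ i f g, f ∉ τ.vars → τ.Adj f g → List.Sublist [(i, f), (i, g)] σ

/-- A global session: a nonempty multiset of local sessions, enumerated by `Fin numUsers`, and
a schedule for that many users. -/
structure GlobalSession where
  numUsers : ℕ
  numUsers_pos : 0 < numUsers
  user : Fin numUsers → τ.LocalSession
  schedule : List (Fin numUsers × N)
  isSchedule : τ.IsSchedule numUsers schedule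

/-- The state in which the run for a global session starts. -/
def initialState (G : τ.GlobalSession) : State N G.numUsers where
  mem := fun i => τ.toAssign (G.user i)
  log := []
  rest := G.schedule
  time := 0

/-- The actions that are available in a state: *wait* requires that there is a next query and
that the user who performs it has values for all its arguments; *reply* requires that the
designated query has been made and is unanswered. -/
def Available {n : ℕ} (s : State N n) : Action N → Prop
  | .wait => ∃ i f σ, s.rest = (i, f) :: σ ∧ ∀ u, τ.Adj u f → s.mem i u ≠ none
  | .reply k _ => ∃ e, s.log[k]? = some e ∧ e.reply = none
  | .print _ => True

open scoped Classical in
/-- The effect of an (available) action on the state. -/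
def perform {n : ℕ} (s : State N n) : Action N → State N n
  | .wait =>
    match s.rest with
    | [] => s
    | (i, f) :: σ =>
      { mem := s.mem
        log := s.log ++ [⟨f, fun u => if τ.Adj u f then s.mem i u else none, i, none⟩]
        rest := σ
        time := s.time + 1 }
  | .reply k r =>
    match s.log[k]? with
    | none => s
    | some e =>
      { mem := Function.update s.mem e.user (Function.update (s.mem e.user) e.node (some r))
        log := s.log.set k { e with reply := some (r, s.time + 1) }
        rest := s.rest
        time := s.time + 1 }
  | .print _ => s

/-- `τ.Occurs P G s`: the state `s` occurs in the run for the global session `G` with the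
strategy `P`. A print action ends the run. -/
inductive Occurs (P : Strategy N) (G : τ.GlobalSession) : State N G.numUsers → Prop
  | start : Occurs P G (τ.initialState G)
  | step (s : State N G.numUsers) : Occurs P G s → (∀ I, P s.view ≠ .print I) →
      τ.Available s (P s.view) → Occurs P G (τ.perform s (P s.view))

/-- A strategy is admissible if it only ever chooses available actions while a run is not over. -/
def Admissible (P : Strategy N) : Prop :=
  ∀ (G : τ.GlobalSession) (s : State N G.numUsers), τ.Occurs P G s → ¬ s.Final →
    τ.Available s (P s.view)

/-- In the run for `G` with strategy `P`, one of the local sessions of `G` is printed. -/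
def Wins (P : Strategy N) (G : τ.GlobalSession) : Prop :=
  ∃ s, τ.Occurs P G s ∧ ∃ i, P s.view = .print (τ.toAssign (G.user i))

/-- A protocol is insecure (against active linking attacks) if some adversary strategy prints,
for every global session, one of its local sessions. -/
def Insecure : Prop :=
  ∃ P : Strategy N, τ.Admissible P ∧ ∀ G : τ.GlobalSession, τ.Wins P G

/-- `u ⇝ v`: there is a directed path (possibly of length `0`) from `u` to `v`. -/
def Reaches (u v : N) : Prop := Relation.ReflTransGen τ.Adj u v

/-- Directed paths, as nonempty lists of nodes. -/
def IsPath (p : List N) : Prop := p ≠ [] ∧ List.IsChain τ.Adj p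

/-- A tracking strategy: a set `T` of query nodes that contains an element from which all of `T`
can be reached (synchronization), and such that there are paths `p x` from all variables `x` into
`T` of which no two share a node outside of `T` (cover condition). -/
structure IsTrackingStrategy (T : Set N) : Prop where
  queryNodes : ∀ t ∈ T, t ∉ τ.vars
  sync : ∃ t₀ ∈ T, ∀ u ∈ T, τ.Reaches t₀ u
  cover : ∃ p : τ.vars → List N,
    (∀ x, τ.IsPath (p x) ∧ (p x).head? = some x.1 ∧ ∃ t ∈ T, (p x).getLast? = some t) ∧
    ∀ x y, x ≠ y → ∀ v, v ∈ p x → v ∈ p y → v ∈ T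

/-- `g` is the root: the only node without outgoing edges. -/
def IsRoot (g : N) : Prop := ∀ v, (∀ w, ¬ τ.Adj v w) ↔ v = g

/-- The longest directed path has length (number of edges) `d`. -/
def HasDepth (d : ℕ) : Prop :=
  (∃ p, τ.IsPath p ∧ p.length = d + 1) ∧ ∀ p, τ.IsPath p → p.length ≤ d + 1

/-- A flat protocol `g(f₁(x⃗₁), …, fₙ(x⃗ₙ))`: `g` is the root, the depth is `2`, and every edge leads
either from a variable to a predecessor `fᵢ` of `g`, or from a query node to `g`. The `fᵢ` are
exactly the predecessors of `g`. -/
structure IsFlat (g : N) : Prop where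
  root : τ.IsRoot g
  depth : τ.HasDepth 2
  form : ∀ u v, τ.Adj u v → (u ∈ τ.vars ∧ τ.Adj v g) ∨ (u ∉ τ.vars ∧ v = g)

/-- In a flat protocol with root `g`, the node `f` has a private variable: one that is an input
to `f` but to no other predecessor of `g`. -/
def HasPrivateVariable (g f : N) : Prop :=
  ∃ x ∈ τ.vars, τ.Adj x f ∧ ∀ f', τ.Adj f' g → f' ≠ f → ¬ τ.Adj x f'

end Protocol

end Linking

end

/-!
In a flat protocol with root `g`, designate one private variable `priv f` for every predecessor `f`
of `g`, and call the remaining variables shared. Both sides of the equivalence hold exactly if some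
`f₀` has all shared variables among its inputs.

**Tracking gives an attack.** A tracking strategy contains at most one predecessor `f₀` of the
root, and its paths send the variables outside the inputs of `f₀` to pairwise different other
predecessors of the root (`IsFlat.exists_matching`). The adversary tags the first query at `f₀` with
`true` and all others with `false`, and uses the reply to each matched `f` to pass on the value of
its variable. The tagged user's query at the root then reveals everything (`trackStrategy_wins`).

**No tracking gives security.** Suppose that every `f` has a shared variable `d f` that is not one of
its inputs. Take one user for each vertex of the cube `H → Bool`, where `H` is the set of shared
variables, and let the `f`-queries ("instances") also be indexed by the cube: instance `w` asks for
`w` on the shared inputs of `f`, and for `w (d f)` on `priv f`. A `Relinking` distributes the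
instances among the users in a way that is realized by local sessions. If all queries at the
predecessors of the root are made first, the adversary sees the same in this phase for all
linkings, and must reply to all queries before the first query at the root, since any user might
come next (`Frame.exists_replies`). Linkings in which every user obtains the same replies cannot be
distinguished afterwards either (`Frame.indist_of_replies`).

So it remains to find, for arbitrary replies, a linking `L` such that for every user there is an
indistinguishable linking without this user's session (`exists_linking`). In `L`, user `v` gets
for each `f` one of the two instances on the line through `v` in direction `d f`. If the two ends of
some line through `v` carry the same reply, exchanging them changes the session at `v` unnoticed.
Otherwise `v` is split: the reply that it obtains at each `f` can be prescribed, and it suffices that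
`v` and some neighbour in a direction `a` obtain the same replies at all `f` with `d f ≠ a`, for
then these two users may exchange all those instances together with the value of `a`. The
neighbour is a split one if there is any; for a lonely `v` it is the neighbour in a fixed direction.
No conflict between these requirements arises, because a vertex next to a lonely one is not split.
-/

noncomputable section

namespace Linking

/-! ### Linkings of the instances of queries -/

/-- A distribution of queries among users indexed by the vertices of the cube `H → Bool`. User `v`
has the values `vertex v` on the shared variables `H`, and performs the instance `inst f v` of the
query `f`. An instance `w` of `f` asks for the values of `w` on the set `inp f` of shared inputs of `f`, so the
two must agree there. -/
structure Relinking (ι H : Type*) (inp : ι → Set H) where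
  vertex : (H → Bool) → (H → Bool)
  inst : ι → Equiv.Perm (H → Bool)
  agree : ∀ f v, ∀ s ∈ inp f, inst f v s = vertex v s

section Cube

variable {ι H : Type*} [DecidableEq H]

/-- The neighbour of the vertex `v` of the cube in direction `a`. -/
def flipAt (v : H → Bool) (a : H) : H → Bool := Function.update v a (!v a)

@[simp] lemma flipAt_same (v : H → Bool) (a : H) : flipAt v a a = !v a := by simp [flipAt]

lemma flipAt_ne (v : H → Bool) {a b : H} (h : b ≠ a) : flipAt v a b = v b := by simp [flipAt, h]

@[simp] lemma flipAt_flipAt (v : H → Bool) (a : H) : flipAt (flipAt v a) a = v := by simp [flipAt]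

lemma flipAt_comm (v : H → Bool) (a b : H) : flipAt (flipAt v a) b = flipAt (flipAt v b) a := by
  funext c
  by_cases h : a = b
  · subst h; rfl
  by_cases ha : c = a
  · subst ha; rw [flipAt_ne _ h, flipAt_same, flipAt_same, flipAt_ne _ h]
  by_cases hb : c = b
  · subst hb; rw [flipAt_same, flipAt_ne _ ha, flipAt_ne _ ha, flipAt_same]
  rw [flipAt_ne _ hb, flipAt_ne _ ha, flipAt_ne _ ha, flipAt_ne _ hb]

/-- The involution of the cube that exchanges `v` and its neighbour in direction `a` whenever
`o v` holds, for a predicate `o` on the lines in direction `a`. -/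
def linePerm (a : H) (o : (H → Bool) → Bool) (ho : ∀ v, o (flipAt v a) = o v) :
    Equiv.Perm (H → Bool) :=
  Function.Involutive.toPerm (fun v => if o v then flipAt v a else v) (by
    intro v
    cases h : o v <;> simp [h, ho])

lemma linePerm_apply (a : H) (o : (H → Bool) → Bool) (ho : ∀ v, o (flipAt v a) = o v)
    (v : H → Bool) : linePerm a o ho v = if o v then flipAt v a else v := rfl

lemma linePerm_of_ne (a : H) (o : (H → Bool) → Bool) (ho : ∀ v, o (flipAt v a) = o v)
    (v : H → Bool) {b : H} (hb : b ≠ a) : linePerm a o ho v b = v b := by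
  rw [linePerm_apply]; split_ifs
  · exact flipAt_ne _ hb
  · rfl

lemma linePerm_flip_same (a : H) (o : (H → Bool) → Bool) (ho : ∀ v, o (flipAt v a) = o v)
    (v : H → Bool) : linePerm a o ho (flipAt v a) a = !linePerm a o ho v a := by
  cases h : o v <;> simp [linePerm_apply, ho, h]

variable (d : ι → H) (r : ι → (H → Bool) → Bool)

/-- All lines through `v` carry two different replies. -/
def Split (v : H → Bool) : Prop := ∀ f, r f v ≠ r f (flipAt v (d f))

/-- `v` is split, but none of its neighbours in the directions `d f` is. -/
def Lonely (v : H → Bool) : Prop := Split d r v ∧ ∀ f, ¬ Split d r (flipAt v (d f))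

/-- The line through the lonely vertex `v` belonging to `f` has a parallel, one step in
direction `a`, whose two ends carry the same reply. -/
def Special (a : H) (f : ι) (v : H → Bool) : Prop :=
  d f ≠ a ∧ Lonely d r v ∧ r f (flipAt v a) = r f (flipAt (flipAt v a) (d f))

open scoped Classical in
/-- The reply that the user at `v` shall obtain at `f` when the line of `f` through `v` carries two
different replies. -/
def target (a : H) (f : ι) (v : H → Bool) : Bool :=
  if Special d r a f v then r f (flipAt v a)
  else if Special d r a f (flipAt v (d f)) then !r f (flipAt (flipAt v (d f)) a)
  else v (d f)

variable {d r}

lemma Special.not_special_flip {a : H} {f : ι} {v : H → Bool} (h : Special d r a f v) :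
    ¬ Special d r a f (flipAt v (d f)) := fun h' => h.2.1.2 f h'.2.1.1

lemma target_flip (a : H) (f : ι) (v : H → Bool) :
    target d r a f (flipAt v (d f)) = !target d r a f v := by
  by_cases h1 : Special d r a f v
  · simp [target, h1, h1.not_special_flip]
  · by_cases h2 : Special d r a f (flipAt v (d f)) <;> simp [target, h1, h2]

lemma split_not_lonely_flip {v : H → Bool} (h : Split d r v) (f : ι) :
    ¬ Lonely d r (flipAt v (d f)) := fun h' => h'.2 f (by rwa [flipAt_flipAt])

lemma target_of_not_special {a : H} {f : ι} {v : H → Bool} (h1 : ¬ Special d r a f v)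
    (h2 : ¬ Special d r a f (flipAt v (d f))) : target d r a f v = v (d f) := by
  simp [target, h1, h2]

/-- The lines on which the two instances are to be exchanged, marked by `o`, can be chosen so that
every line with two different replies realizes its target. -/
lemma exists_orientation (a : H) : ∃ o : ι → (H → Bool) → Bool,
    ∃ ho : ∀ f v, o f (flipAt v (d f)) = o f v,
      (∀ f v, r f v ≠ r f (flipAt v (d f)) →
        r f (linePerm (d f) (o f) (ho f) v) = target d r a f v) ∧
      (∀ f v, r f v = r f (flipAt v (d f)) → r f (linePerm (d f) (o f) (ho f) v) = r f v) := by
  classical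
  refine ⟨fun f v => decide (r f v ≠ r f (flipAt v (d f)) ∧ r f v ≠ target d r a f v), ?_, ?_, ?_⟩
  · intro f v
    simp only [flipAt_flipAt, target_flip]
    generalize r f v = x
    generalize r f (flipAt v (d f)) = y
    generalize target d r a f v = z
    revert x y z; decide
  · intro f v h
    rw [linePerm_apply]
    by_cases h2 : r f v = target d r a f v
    · simp [h2]
    · rw [if_pos (by simp [h, h2])]
      revert h h2
      generalize r f v = x
      generalize r f (flipAt v (d f)) = y
      generalize target d r a f v = z
      revert x y z; decide
  · intro f v h
    rw [linePerm_apply, if_neg (by simp [h])]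

/-- The heart of the security argument: whatever the replies `r` to the instances, there is a
linking such that no user's session is shared by all linkings in which every user obtains the same
replies. -/
theorem exists_linking [Nonempty ι] (inp : ι → Set H) (hd : ∀ f, d f ∉ inp f) :
    ∃ L : Relinking ι H inp, ∀ h, ∃ L' : Relinking ι H inp,
      (∀ f v, r f (L'.inst f v) = r f (L.inst f v)) ∧
      ∀ v, L'.vertex v ≠ L.vertex h ∨ ∃ f, L'.inst f v (d f) ≠ L.inst f h (d f) := by
  classical
  obtain ⟨f₁⟩ := ‹Nonempty ι›
  obtain ⟨o, ho, hz, hz'⟩ := exists_orientation (d := d) (r := r) (d f₁)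
  set π : ι → Equiv.Perm (H → Bool) := fun f => linePerm (d f) (o f) (ho f) with hπ
  have hagree : ∀ f v, ∀ s ∈ inp f, π f v s = v s := fun f v s hs =>
    linePerm_of_ne _ _ _ _ (by rintro rfl; exact hd f hs)
  have hflip : ∀ f v, π f (flipAt v (d f)) (d f) ≠ π f v (d f) := fun f v => by
    rw [hπ]; simp only [linePerm_flip_same]; simp
  refine ⟨⟨id, π, hagree⟩, fun h => ?_⟩
  by_cases hN : Split d r h
  · -- A neighbour of `h` that obtains the same replies as `h` at all queries whose lines do not
    -- join the two.
    obtain ⟨f₀, key⟩ : ∃ f₀, ∀ f, d f ≠ d f₀ → r f (π f h) = r f (π f (flipAt h (d f₀))) := by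
      by_cases hL : Lonely d r h
      · refine ⟨f₁, fun f hf => ?_⟩
        have hs2 : ¬ Special d r (d f₁) f (flipAt h (d f)) := fun h' => hL.2 f h'.2.1.1
        by_cases hc : r f (flipAt h (d f₁)) = r f (flipAt (flipAt h (d f₁)) (d f))
        · rw [hz f h (hN f), hz' f _ hc, target, if_pos ⟨hf, hL, hc⟩]
        · rw [hz f h (hN f), hz f _ hc,
            target_of_not_special (fun h' => hc h'.2.2) hs2, target_of_not_special, flipAt_ne _ hf]
          · intro h'
            have := h'.2.2
            rw [flipAt_flipAt] at this
            exact hN f this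
          · intro h'
            have := h'.2.2
            rw [flipAt_comm, flipAt_comm h, flipAt_flipAt, flipAt_flipAt] at this
            exact hN f this.symm
      · obtain ⟨f₀, hf₀⟩ : ∃ f, Split d r (flipAt h (d f)) := by
          by_contra hcon
          exact hL ⟨hN, not_exists.mp hcon⟩
        refine ⟨f₀, fun f hf => ?_⟩
        rw [hz f h (hN f), hz f _ (hf₀ f),
          target_of_not_special (fun h' => hL h'.2.1)
            (fun h' => split_not_lonely_flip hN f h'.2.1),
          target_of_not_special (fun h' => split_not_lonely_flip hN f₀ h'.2.1)
            (fun h' => split_not_lonely_flip hf₀ f h'.2.1), flipAt_ne _ hf]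
    set h' := flipAt h (d f₀) with hh'
    have hne : h ≠ h' := fun e => by
      have := congrFun e (d f₀)
      simp [hh'] at this
    refine ⟨⟨Equiv.swap h h', fun f => if d f = d f₀ then π f else (Equiv.swap h h').trans (π f),
      ?_⟩, ?_, ?_⟩
    · intro f v s hs
      split_ifs with hf
      · rw [hagree f v s hs]
        have hsne : s ≠ d f₀ := by rintro rfl; rw [← hf] at hs; exact hd f hs
        rcases eq_or_ne v h with rfl | h1
        · rw [Equiv.swap_apply_left, hh', flipAt_ne _ hsne]
        rcases eq_or_ne v h' with rfl | h2
        · rw [Equiv.swap_apply_right, hh', flipAt_ne _ hsne]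
        rw [Equiv.swap_apply_of_ne_of_ne h1 h2]
      · exact hagree f _ s hs
    · intro f v
      dsimp only
      split_ifs with hf
      · rfl
      · rw [Equiv.trans_apply]
        rcases eq_or_ne v h with rfl | h1
        · rw [Equiv.swap_apply_left]; exact (key f hf).symm
        rcases eq_or_ne v h' with rfl | h2
        · rw [Equiv.swap_apply_right]; exact key f hf
        rw [Equiv.swap_apply_of_ne_of_ne h1 h2]
    · intro v
      rcases eq_or_ne v h' with rfl | h2
      · right
        exact ⟨f₀, by simpa using hflip f₀ h⟩
      · left
        intro e
        apply h2
        have e' : Equiv.swap h h' v = h := e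
        rw [Equiv.swap_apply_eq_iff.mp e', Equiv.swap_apply_left]
  · -- On a line with equal replies at its ends the two instances may be exchanged.
    obtain ⟨f₀, hf₀⟩ : ∃ f, r f h = r f (flipAt h (d f)) := by
      simpa [Split] using hN
    refine ⟨⟨id, Function.update π f₀ ((Equiv.swap h (flipAt h (d f₀))).trans (π f₀)), ?_⟩, ?_, ?_⟩
    · intro f v s hs
      rcases eq_or_ne f f₀ with rfl | hf
      · rw [Function.update_self, Equiv.trans_apply, hagree f _ s hs]
        have hsne : s ≠ d f := by rintro rfl; exact hd f hs
        rcases eq_or_ne v h with rfl | h1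
        · rw [Equiv.swap_apply_left, flipAt_ne _ hsne]; rfl
        rcases eq_or_ne v (flipAt h (d f)) with rfl | h2
        · rw [Equiv.swap_apply_right, id, flipAt_ne _ hsne]
        rw [Equiv.swap_apply_of_ne_of_ne h1 h2]; rfl
      · rw [Function.update_of_ne hf]; exact hagree f v s hs
    · intro f v
      rcases eq_or_ne f f₀ with rfl | hf
      · have e1 : r f (π f h) = r f h := hz' f h hf₀
        have e2 : r f (π f (flipAt h (d f))) = r f (flipAt h (d f)) :=
          hz' f _ (by rw [flipAt_flipAt]; exact hf₀.symm)
        simp only [Function.update_self, Equiv.trans_apply]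
        rcases eq_or_ne v h with rfl | h1
        · rw [Equiv.swap_apply_left, e1, e2, hf₀]
        rcases eq_or_ne v (flipAt h (d f)) with rfl | h2
        · rw [Equiv.swap_apply_right, e1, e2, hf₀]
        rw [Equiv.swap_apply_of_ne_of_ne h1 h2]
      · simp only [Function.update_of_ne hf]
    · intro v
      rcases eq_or_ne v h with rfl | h1
      · right
        exact ⟨f₀, by simpa using hflip f₀ v⟩
      · left; exact h1

end Cube


/-! ### Runs -/

/-- The bit with which the `k`-th query of a view has been answered, if there is one. -/
def View.bit {N : Type*} (w : View N) (k : ℕ) : Option Bool :=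
  (w.queries[k]?.bind ViewEntry.reply).map Prod.fst

namespace Protocol

variable {N : Type*} {τ : Protocol N} {P : Strategy N} {G : τ.GlobalSession}

open scoped Classical in
/-- What holds in every state of a run: the log is the part of the schedule performed so far, the
users know their variables and the replies to their own queries, and the arguments recorded with
a query are still the (defined) values of the user who made it. -/
structure Inv (G : τ.GlobalSession) (s : State N G.numUsers) : Prop where
  sched : s.log.map (fun e => (e.user, e.node)) ++ s.rest = G.schedule
  mem_var : ∀ i x (hx : x ∈ τ.vars), s.mem i x = some (G.user i ⟨x, hx⟩)
  mem_query : ∀ k i f, G.schedule[k]? = some (i, f) → s.mem i f = s.view.bit k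
  args_eq : ∀ e ∈ s.log, e.args = fun u => if τ.Adj u e.node then s.mem e.user u else none
  args_def : ∀ e ∈ s.log, ∀ u, τ.Adj u e.node → s.mem e.user u ≠ none

lemma view_bit {n : ℕ} (s : State N n) (k : ℕ) :
    s.view.bit k = (s.log[k]?.bind Entry.reply).map Prod.fst := by
  simp only [View.bit, State.view, List.getElem?_map]
  cases s.log[k]? <;> rfl

lemma Inv.getElem?_schedule {s : State N G.numUsers} (h : Inv G s) {k : ℕ}
    {e : Entry N G.numUsers} (hk : s.log[k]? = some e) :
    G.schedule[k]? = some (e.user, e.node) := by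
  obtain ⟨hlt, -⟩ := List.getElem?_eq_some_iff.mp hk
  rw [← h.sched, List.getElem?_append_left (by simpa using hlt), List.getElem?_map, hk]
  rfl

lemma Inv.node_not_mem_vars {s : State N G.numUsers} (h : Inv G s) {e : Entry N G.numUsers}
    (he : e ∈ s.log) : e.node ∉ τ.vars := by
  rw [← G.isSchedule.mem_iff e.user, ← h.sched]
  exact List.mem_append_left _ (List.mem_map.mpr ⟨e, he, rfl⟩)

lemma Inv.mem_of_log {s : State N G.numUsers} (h : Inv G s) {e : Entry N G.numUsers}
    (he : e ∈ s.log) : s.mem e.user e.node = e.reply.map Prod.fst := by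
  obtain ⟨k, hk⟩ := List.mem_iff_getElem?.mp he
  rw [h.mem_query k _ _ (h.getElem?_schedule hk), view_bit, hk]
  rfl

lemma inv_initialState (G : τ.GlobalSession) : Inv G (τ.initialState G) where
  sched := by simp [initialState]
  mem_var := fun i x hx => by simp [initialState, toAssign, hx]
  mem_query := fun k i f hk => by
    have hf : f ∉ τ.vars := (G.isSchedule.mem_iff i f).mp (List.mem_of_getElem? hk)
    simp [initialState, toAssign, hf, view_bit]
  args_eq := fun e he => by simp [initialState] at he
  args_def := fun e he => by simp [initialState] at he

lemma perform_wait {n : ℕ} {s : State N n} {i : Fin n} {f : N} {σ : List (Fin n × N)}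
    (h : s.rest = (i, f) :: σ) : ∃ a, (∀ u, τ.Adj u f → a u = s.mem i u) ∧
      (∀ u, ¬ τ.Adj u f → a u = none) ∧ τ.perform s .wait =
        { mem := s.mem, log := s.log ++ [⟨f, a, i, none⟩], rest := σ, time := s.time + 1 } := by
  classical
  refine ⟨fun u => if τ.Adj u f then s.mem i u else none, fun u hu => if_pos hu,
    fun u hu => if_neg hu, ?_⟩
  simp only [perform, h]

open scoped Classical in
lemma perform_reply {n : ℕ} {s : State N n} {k : ℕ} {r : Bool} {e : Entry N n}
    (h : s.log[k]? = some e) : τ.perform s (.reply k r) =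
      { mem := Function.update s.mem e.user (Function.update (s.mem e.user) e.node (some r))
        log := s.log.set k { e with reply := some (r, s.time + 1) }
        rest := s.rest
        time := s.time + 1 } := by
  simp only [perform, h]

open scoped Classical in
lemma Inv.perform {s : State N G.numUsers} (h : Inv G s) {a : Action N}
    (ha : τ.Available s a) : Inv G (τ.perform s a) := by
  cases a with
  | print I => exact h
  | wait =>
    obtain ⟨i, f, σ, hrest, hdef⟩ := ha
    obtain ⟨a, ha1, ha2, hp⟩ := perform_wait (τ := τ) hrest
    rw [hp]
    refine ⟨?_, h.mem_var, ?_, ?_, ?_⟩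
    · rw [← h.sched, hrest]; simp
    · intro k j f' hk
      change s.mem j f' = _
      rw [h.mem_query k j f' hk, view_bit, view_bit]
      dsimp only
      rcases lt_trichotomy k s.log.length with hlt | rfl | hgt
      · rw [List.getElem?_append_left hlt]
      · simp
      · rw [List.getElem?_eq_none hgt.le, List.getElem?_eq_none (by simpa using hgt)]
    · intro e he
      rcases List.mem_append.mp he with he | he
      · exact h.args_eq e he
      · rw [List.mem_singleton] at he
        subst he
        funext u
        by_cases hu : τ.Adj u f
        · simp [hu, ha1]
        · simp [hu, ha2]
    · intro e he
      rcases List.mem_append.mp he with he | he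
      · exact h.args_def e he
      · rw [List.mem_singleton] at he
        subst he
        exact hdef
  | reply k r =>
    obtain ⟨e, hk, hnone⟩ := ha
    rw [perform_reply hk]
    have hlt : k < s.log.length := (List.getElem?_eq_some_iff.mp hk).1
    have hmem : e ∈ s.log := List.mem_of_getElem? hk
    have hsched := h.getElem?_schedule hk
    -- values at other places than the answered one are not affected
    have hne : ∀ j u, (j, u) ≠ (e.user, e.node) → Function.update s.mem e.user
        (Function.update (s.mem e.user) e.node (some r)) j u = s.mem j u := by
      intro j u hju
      by_cases hj : j = e.user
      · subst hj
        rw [Function.update_self, Function.update_of_ne]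
        rintro rfl; exact hju rfl
      · rw [Function.update_of_ne hj]
    -- the arguments of recorded queries are defined, hence not the place that is being answered
    have hold : ∀ e' ∈ s.log, ∀ u, τ.Adj u e'.node → Function.update s.mem e.user
        (Function.update (s.mem e.user) e.node (some r)) e'.user u = s.mem e'.user u := by
      intro e' he' u hu
      apply hne
      intro heq
      obtain ⟨h1, h2⟩ := Prod.mk.inj heq
      apply h.args_def e' he' u hu
      rw [h1, h2, h.mem_of_log hmem, hnone]
      rfl
    have hset : ∀ e' ∈ s.log.set k { e with reply := some (r, s.time + 1) },
        ∃ e'' ∈ s.log, e''.user = e'.user ∧ e''.node = e'.node ∧ e''.args = e'.args := by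
      intro e' he'
      rcases List.mem_or_eq_of_mem_set he' with he' | rfl
      · exact ⟨e', he', rfl, rfl, rfl⟩
      · exact ⟨e, hmem, rfl, rfl, rfl⟩
    refine ⟨?_, ?_, ?_, ?_, ?_⟩
    · rw [← h.sched]
      dsimp only
      congr 1
      rw [List.map_set]
      apply List.ext_getElem?
      intro m
      rw [List.getElem?_set]
      split_ifs with h1 h2
      · subst h1; simp [hk]
      · exact absurd hlt (by subst h1; simpa using h2)
      · rfl
    · intro i x hx
      dsimp only
      rw [hne, h.mem_var i x hx]
      rintro heq
      obtain ⟨-, rfl⟩ := Prod.mk.inj heq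
      exact h.node_not_mem_vars hmem hx
    · intro m j f hm
      rw [view_bit]
      dsimp only
      by_cases hmk : m = k
      · subst hmk
        rw [hsched] at hm
        obtain ⟨rfl, rfl⟩ := Prod.mk.inj (Option.some.inj hm)
        simp [hlt]
      · rw [hne, h.mem_query m j f hm, view_bit, List.getElem?_set_ne (Ne.symm hmk)]
        intro heq
        rw [heq, ← hsched] at hm
        refine hmk ((List.getElem?_inj ?_ G.isSchedule.nodup).mp hm)
        by_contra hcon
        rw [List.getElem?_eq_none (not_lt.mp hcon), hsched] at hm
        cases hm
    · intro e' he'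
      obtain ⟨e'', he'', h1, h2, h3⟩ := hset e' he'
      rw [← h1, ← h2, ← h3, h.args_eq e'' he'']
      funext u
      dsimp only
      split_ifs with hu
      · rw [hold e'' he'' u hu]
      · rfl
    · intro e' he' u hu
      obtain ⟨e'', he'', h1, h2, -⟩ := hset e' he'
      dsimp only
      rw [← h2] at hu
      rw [← h1, hold e'' he'' u hu]
      exact h.args_def e'' he'' u hu

lemma Occurs.inv {s : State N G.numUsers} (h : τ.Occurs P G s) : Inv G s := by
  induction h with
  | start => exact inv_initialState G
  | step s _ _ ha ih => exact ih.perform ha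

/-- If all recorded queries are answered and the schedule is not exhausted, the adversary may
wait. -/
lemma Inv.available_wait {s : State N G.numUsers} (h : Inv G s)
    (hans : ∀ e ∈ s.log, e.reply ≠ none) (hrest : s.rest ≠ []) : τ.Available s .wait := by
  obtain ⟨⟨i, f⟩, σ, hσ⟩ := List.exists_cons_of_ne_nil hrest
  refine ⟨i, f, σ, hσ, fun u hu => ?_⟩
  by_cases hx : u ∈ τ.vars
  · simp [h.mem_var i u hx]
  · have hsub := G.isSchedule.order i u f hx hu
    have hnd := G.isSchedule.nodup
    rw [← h.sched, hσ] at hsub hnd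
    have hmem : (i, u) ∈ s.log.map (fun e => (e.user, e.node)) := by
      by_contra hcon
      obtain ⟨l₁, l₂, h12, h1, h2⟩ := List.sublist_append_iff.mp hsub
      cases l₁ with
      | nil =>
        rw [List.nil_append] at h12
        rw [← h12, List.sublist_cons_iff] at h2
        have hnd2 := (List.nodup_append.mp hnd).2.1
        rcases h2 with h2 | ⟨l, h2, h3⟩
        · exact (List.nodup_cons.mp hnd2).1 (h2.subset (by simp))
        · obtain ⟨h4, rfl⟩ := List.cons.inj h2
          exact (List.nodup_cons.mp hnd2).1 (h3.subset (by simp))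
      | cons p l =>
        obtain ⟨rfl, -⟩ := List.cons.inj h12
        exact hcon (h1.subset (by simp))
    obtain ⟨e, he, heq⟩ := List.mem_map.mp hmem
    obtain ⟨rfl, rfl⟩ := Prod.mk.inj heq
    rw [h.mem_of_log he]
    simpa using hans e he

open scoped Classical in
/-- The state of the run after (at most) `n` actions. -/
def run (P : Strategy N) (G : τ.GlobalSession) : ℕ → State N G.numUsers
  | 0 => τ.initialState G
  | n + 1 =>
    if (∀ I, P (run P G n).view ≠ .print I) ∧ τ.Available (run P G n) (P (run P G n).view) then
      τ.perform (run P G n) (P (run P G n).view)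
    else run P G n

lemma occurs_run (n : ℕ) : τ.Occurs P G (run P G n) := by
  induction n with
  | zero => exact .start
  | succ n ih =>
    rw [run]
    split_ifs with h
    · exact .step _ ih h.1 h.2
    · exact ih

lemma Occurs.exists_run {s : State N G.numUsers} (h : τ.Occurs P G s) : ∃ n, s = run P G n := by
  induction h with
  | start => exact ⟨0, rfl⟩
  | step s _ hp ha ih =>
    obtain ⟨n, rfl⟩ := ih
    exact ⟨n + 1, by rw [run, if_pos ⟨hp, ha⟩]⟩

lemma inv_run (n : ℕ) : Inv G (run P G n) := (occurs_run n).inv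

/-- A printing state is not left any more. -/
lemma run_of_print {n : ℕ} {I : Assign N} (h : P (run P G n).view = .print I) {m : ℕ}
    (hm : n ≤ m) : run P G m = run P G n := by
  induction m, hm using Nat.le_induction with
  | base => rfl
  | succ m _ ih => rw [run, ih, if_neg]; exact fun h' => h'.1 I h

lemma perform_length_le {n : ℕ} (s : State N n) (a : Action N) :
    s.log.length ≤ (τ.perform s a).log.length := by
  cases a with
  | print I => exact le_rfl
  | wait => rw [perform]; split <;> simp
  | reply k r => rw [perform]; split <;> simp

lemma run_length_mono {m n : ℕ} (h : m ≤ n) :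
    (run P G m).log.length ≤ (run P G n).log.length := by
  induction n, h using Nat.le_induction with
  | base => exact le_rfl
  | succ n _ ih =>
    rw [run]
    split_ifs
    · exact ih.trans (perform_length_le _ _)
    · exact ih

/-- Replies are never changed. -/
lemma bit_perform {n : ℕ} {s : State N n} {a : Action N} (ha : τ.Available s a) {k : ℕ} {b : Bool}
    (hb : s.view.bit k = some b) : (τ.perform s a).view.bit k = some b := by
  rw [view_bit] at hb ⊢
  cases a with
  | print I => exact hb
  | wait =>
    obtain ⟨i, f, σ, hrest, -⟩ := ha
    obtain ⟨a, -, -, hp⟩ := perform_wait (τ := τ) hrest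
    rw [hp]
    dsimp only
    rcases lt_or_ge k s.log.length with hlt | hge
    · rwa [List.getElem?_append_left hlt]
    · rw [List.getElem?_eq_none hge] at hb
      cases hb
  | reply j r =>
    obtain ⟨e, hk, hnone⟩ := ha
    rw [perform_reply hk]
    dsimp only
    rw [List.getElem?_set_ne, hb]
    rintro rfl
    simp [hk, hnone] at hb

lemma bit_run_mono {m n : ℕ} (h : m ≤ n) {k : ℕ} {b : Bool}
    (hb : (run P G m).view.bit k = some b) : (run P G n).view.bit k = some b := by
  induction n, h using Nat.le_induction with
  | base => exact hb
  | succ n _ ih =>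
    rw [run]
    split_ifs with h
    · exact bit_perform h.2 ih
    · exact ih

end Protocol
namespace Protocol

variable {N : Type*} {τ : Protocol N} {g : N}

/-! ### Flat protocols -/

lemma IsFlat.adj_of_adj (h : τ.IsFlat g) {x f : N} (hx : x ∈ τ.vars) (hf : τ.Adj x f) :
    τ.Adj f g := by
  rcases h.form x f hf with h' | h'
  · exact h'.2
  · exact absurd hx h'.1

lemma not_adj_self (v : N) : ¬ τ.Adj v v := fun h => τ.acyclic v (.single h)

lemma IsFlat.pred_not_mem_vars (h : τ.IsFlat g) {f : N} (hf : τ.Adj f g) : f ∉ τ.vars := by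
  intro hv
  rcases h.form f g hf with h' | h'
  · exact not_adj_self g h'.2
  · exact h'.1 hv

lemma IsFlat.mem_vars_of_adj (h : τ.IsFlat g) {u f : N} (hf : τ.Adj f g) (hu : τ.Adj u f) :
    u ∈ τ.vars := by
  rcases h.form u f hu with h' | h'
  · exact h'.1
  · exact absurd (h'.2 ▸ hf) (not_adj_self g)

lemma IsFlat.root_not_mem_vars (h : τ.IsFlat g) : g ∉ τ.vars := by
  intro hv
  obtain ⟨p, ⟨-, hp⟩, hlen⟩ := h.depth.1
  match p, hp, hlen with
  | [a, b, c], hp, _ =>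
    simp only [List.isChain_cons_cons] at hp
    rcases h.form b c hp.2.1 with h' | h'
    · exact τ.vars_source a b h'.1 hp.1
    · exact τ.vars_source b g hv (h'.2 ▸ hp.2.1)

lemma IsFlat.exists_adj (h : τ.IsFlat g) {v : N} (hv : v ≠ g) : ∃ w, τ.Adj v w := by
  by_contra hcon
  exact hv ((h.root v).mp (not_exists.mp hcon))

lemma IsFlat.adj_root (h : τ.IsFlat g) {f : N} (hf : f ∉ τ.vars) (hg : f ≠ g) : τ.Adj f g := by
  obtain ⟨w, hw⟩ := h.exists_adj hg
  rcases h.form f w hw with h' | h'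
  · exact absurd h'.1 hf
  · exact h'.2 ▸ hw

lemma IsFlat.exists_query (h : τ.IsFlat g) {x : N} (hx : x ∈ τ.vars) :
    ∃ f, τ.Adj x f ∧ τ.Adj f g := by
  obtain ⟨f, hf⟩ := h.exists_adj (v := x) (by rintro rfl; exact h.root_not_mem_vars hx)
  exact ⟨f, hf, h.adj_of_adj hx hf⟩

/-! ### From tracking strategies to adversaries -/

/-- The variables that are not inputs of `f`. -/
def nonInputs (τ : Protocol N) (f : N) : Set N := {x | x ∈ τ.vars ∧ ¬ τ.Adj x f}

/-- In a flat protocol, a tracking strategy provides a node `f₀` such that the variables outside its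
inputs are inputs of pairwise different other predecessors of the root. -/
lemma IsFlat.exists_matching (h : τ.IsFlat g) {T : Set N} (hT : τ.IsTrackingStrategy T) :
    ∃ f₀, τ.Adj f₀ g ∧ ∃ φ : N → N, Set.InjOn φ (τ.nonInputs f₀) ∧
      ∀ x ∈ τ.nonInputs f₀, τ.Adj x (φ x) ∧ φ x ≠ f₀ := by
  classical
  have hroot : ∀ w, ¬ τ.Adj g w := (h.root g).mpr rfl
  -- apart from the root, `T` has at most one element
  have huniq : ∀ f f', f ∈ T → f' ∈ T → f ≠ g → f' ≠ g → f = f' := by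
    obtain ⟨t, ht, hreach⟩ := hT.sync
    have aux : ∀ f ∈ T, f ≠ g → f = t := by
      intro f hf hfg
      rcases (hreach f hf).cases_head with e | ⟨w, hw, hwf⟩
      · exact e.symm
      · rcases h.form t w hw with h' | h'
        · exact absurd h'.1 (hT.queryNodes t ht)
        · rw [h'.2] at hwf
          rcases hwf.cases_head with e | ⟨w', hw', -⟩
          · exact absurd e.symm hfg
          · exact absurd hw' (hroot w')
    exact fun f f' hf hf' h1 h2 => (aux f hf h1).trans (aux f' hf' h2).symm
  obtain ⟨f₀, hf₀, hTf⟩ : ∃ f₀, τ.Adj f₀ g ∧ ∀ f ∈ T, f ≠ g → f = f₀ := by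
    by_cases hex : ∃ f ∈ T, f ≠ g
    · obtain ⟨f, hf, hfg⟩ := hex
      exact ⟨f, h.adj_root (hT.queryNodes f hf) hfg, fun f' hf' h' => huniq f' f hf' hf h' hfg⟩
    · obtain ⟨x, hx⟩ := τ.vars_nonempty
      obtain ⟨f, -, hf⟩ := h.exists_query hx
      exact ⟨f, hf, fun f' hf' h' => absurd ⟨f', hf', h'⟩ hex⟩
  obtain ⟨p, hp, hdisj⟩ := hT.cover
  have hnode : ∀ x : τ.vars, ∃ f ∈ p x, τ.Adj x.1 f := by
    intro x
    obtain ⟨⟨-, hc⟩, hhead, t, ht, hlast⟩ := hp x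
    match hpx : p x, hc, hhead, hlast with
    | [a], _, hhead, hlast =>
      simp only [List.head?_cons, List.getLast?_singleton, Option.some.injEq] at hhead hlast
      exact absurd x.2 (by rw [← hhead, hlast]; exact hT.queryNodes t ht)
    | a :: b :: l, hc, hhead, _ =>
      simp only [List.head?_cons, Option.some.injEq] at hhead
      rw [List.isChain_cons_cons] at hc
      exact ⟨b, by simp, hhead ▸ hc.1⟩
  choose φ hφp hφ using hnode
  refine ⟨f₀, hf₀, fun x => if hx : x ∈ τ.vars then φ ⟨x, hx⟩ else x, ?_, ?_⟩
  · rintro x ⟨hx, hxf⟩ y ⟨hy, -⟩ hxy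
    simp only [hx, hy, dif_pos] at hxy
    by_contra hne
    have hmem := hdisj ⟨x, hx⟩ ⟨y, hy⟩ (fun e => hne (congrArg Subtype.val e)) _
      (hφp ⟨x, hx⟩) (hxy ▸ hφp ⟨y, hy⟩)
    have hadj := hφ ⟨x, hx⟩
    have hfg : φ ⟨x, hx⟩ ≠ g := fun e => by
      have := h.adj_of_adj hx hadj
      rw [e] at this
      exact not_adj_self g this
    exact hxf (hTf _ hmem hfg ▸ hadj)
  · rintro x ⟨hx, hxf⟩
    simp only [hx, dif_pos]
    exact ⟨hφ ⟨x, hx⟩, fun e => hxf (e ▸ hφ ⟨x, hx⟩)⟩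

section Adversary

variable (τ) (g f₀ : N) (φ : N → N)

open scoped Classical in
/-- The tracking adversary's reply to the `k`-th query: the first query at `f₀` is tagged with
`true` and all later ones with `false`, while at `φ x` the value of the variable `x` is passed on. -/
def trackReply (qs : List (N × Assign N)) (k : ℕ) : Bool :=
  match qs[k]? with
  | none => false
  | some (f, a) =>
    if f = f₀ then decide (∀ j < k, ∀ q, qs[j]? = some q → q.1 ≠ f₀)
    else if h : ∃ x ∈ τ.nonInputs f₀, φ x = f then (a h.choose).getD false
    else false

open scoped Classical in
/-- The local session recovered from the tagged query `q` at `f₀` and the query `q'` at the root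
that has received the tag. -/
def trackGuess (q q' : ViewEntry N) : Assign N := fun u =>
  if u ∈ τ.vars then (if τ.Adj u f₀ then q.args u else q'.args (φ u)) else none

/-- `q` is the tagged query at `f₀`, and `q'` a query at the root that has received the tag. -/
def TrackFound (w : View N) (q q' : ViewEntry N) : Prop :=
  q ∈ w.queries ∧ q' ∈ w.queries ∧ q.node = f₀ ∧ q.reply.map Prod.fst = some true ∧
    q'.node = g ∧ q'.args f₀ = some true

open scoped Classical in
/-- The adversary that follows a single user through `f₀` to the root. It prints as soon as the tag
has reached the root; before that, it answers pending queries, and waits when there are none. -/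
def trackStrategy : Strategy N := fun w =>
  if h : ∃ q q', TrackFound g f₀ w q q' then
    .print (trackGuess τ f₀ φ h.choose h.choose_spec.choose)
  else if h : ∃ k q, w.queries[k]? = some q ∧ q.reply = none then
    .reply h.choose (trackReply τ f₀ φ (w.queries.map fun q => (q.node, q.args)) h.choose)
  else .wait

variable {τ g f₀ φ}

lemma trackReply_append {l l' : List (N × Assign N)} {k : ℕ} (hk : k < l.length) :
    trackReply τ f₀ φ (l ++ l') k = trackReply τ f₀ φ l k := by
  have h1 : ∀ j ≤ k, (l ++ l')[j]? = l[j]? := fun j hj =>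
    List.getElem?_append_left (hj.trans_lt hk)
  have h2 : (∀ j < k, ∀ q, (l ++ l')[j]? = some q → q.1 ≠ f₀) ↔
      ∀ j < k, ∀ q, l[j]? = some q → q.1 ≠ f₀ :=
    forall₂_congr fun j hj => by rw [h1 j hj.le]
  simp only [trackReply, h1 k le_rfl]
  rcases l[k]? with _ | ⟨f, a⟩
  · rfl
  · by_cases hf : f = f₀
    · simp only [hf, if_true]
      exact decide_eq_decide.mpr h2
    · simp only [hf, if_false]

/-- The queries of a state, without their users and replies. -/
def logQueries {n : ℕ} (s : State N n) : List (N × Assign N) := s.log.map fun e => (e.node, e.args)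

lemma view_queries_map {n : ℕ} (s : State N n) :
    (s.view.queries.map fun q => (q.node, q.args)) = logQueries s := by
  simp [State.view, logQueries, Function.comp_def]

open scoped Classical in
lemma Occurs.bit_eq_trackReply {G : τ.GlobalSession} {s : State N G.numUsers}
    (h : τ.Occurs (trackStrategy τ g f₀ φ) G s) :
    ∀ k b, s.view.bit k = some b → b = trackReply τ f₀ φ (logQueries s) k := by
  induction h with
  | start => intro k b hb; simp [view_bit, initialState] at hb
  | step s hs hp ha ih =>
    intro k b hb
    generalize hact : trackStrategy τ g f₀ φ s.view = a at ha hb hp ⊢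
    cases a with
    | print I => exact absurd rfl (hp I)
    | wait =>
      obtain ⟨i, f, σ, hrest, -⟩ := ha
      obtain ⟨a, -, -, hperf⟩ := perform_wait (τ := τ) hrest
      rw [hperf] at hb ⊢
      rw [view_bit] at hb
      simp only [logQueries, List.map_append] at hb ⊢
      rcases lt_trichotomy k s.log.length with hlt | rfl | hgt
      · rw [trackReply_append (by simpa using hlt)]
        rw [List.getElem?_append_left hlt, ← view_bit] at hb
        exact ih k b hb
      · simp at hb
      · rw [List.getElem?_eq_none (by simpa using hgt)] at hb
        simp at hb
    | reply k₀ r =>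
      obtain ⟨e, hk, hnone⟩ := ha
      have hlt : k₀ < s.log.length := (List.getElem?_eq_some_iff.mp hk).1
      have hr : r = trackReply τ f₀ φ (logQueries s) k₀ := by
        rw [trackStrategy] at hact
        split_ifs at hact
        rw [view_queries_map] at hact
        obtain ⟨rfl, rfl⟩ := Action.reply.inj hact
        rfl
      rw [perform_reply hk] at hb ⊢
      have hq : logQueries (⟨Function.update s.mem e.user
          (Function.update (s.mem e.user) e.node (some r)),
          s.log.set k₀ { e with reply := some (r, s.time + 1) }, s.rest, s.time + 1⟩ :
          State N G.numUsers) = logQueries s := by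
        simp only [logQueries, List.map_set]
        apply List.ext_getElem?
        intro m
        rw [List.getElem?_set]
        split_ifs with h1 h2
        · subst h1; simp [hk]
        · exact absurd hlt (by subst h1; simpa using h2)
        · rfl
      rw [hq]
      rw [view_bit] at hb
      dsimp only at hb
      by_cases hkk : k = k₀
      · subst hkk
        simp only [List.getElem?_set_self hlt, Option.bind_some, Option.map_some,
          Option.some.injEq] at hb
        rw [← hb, hr]
      · rw [List.getElem?_set_ne (Ne.symm hkk), ← view_bit] at hb
        exact ih k b hb

lemma trackStrategy_available {G : τ.GlobalSession} {s : State N G.numUsers} (hI : Inv G s)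
    (hfin : ¬ s.Final) : τ.Available s (trackStrategy τ g f₀ φ s.view) := by
  rw [trackStrategy]
  split_ifs with h1 h2
  · trivial
  · obtain ⟨q, hq, hn⟩ := h2.choose_spec
    generalize h2.choose = k at hq ⊢
    simp only [State.view, List.getElem?_map, Option.map_eq_some_iff] at hq
    obtain ⟨e, he, rfl⟩ := hq
    exact ⟨e, he, hn⟩
  · have hans : ∀ e ∈ s.log, e.reply ≠ none := by
      intro e he hn
      obtain ⟨k, hk⟩ := List.mem_iff_getElem?.mp he
      exact h2 ⟨k, ⟨e.node, e.args, e.reply⟩, by simp [State.view, hk], hn⟩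
    exact hI.available_wait hans fun hr => hfin ⟨hr, hans⟩

/-- A bound for the number of actions that are left in a run. -/
def workLeft {n : ℕ} (s : State N n) : ℕ :=
  2 * s.rest.length + s.log.countP fun e => e.reply.isNone

lemma workLeft_perform {n : ℕ} {s : State N n} {a : Action N} (ha : τ.Available s a)
    (hp : ∀ I, a ≠ .print I) : workLeft (τ.perform s a) < workLeft s := by
  cases a with
  | print I => exact absurd rfl (hp I)
  | wait =>
    obtain ⟨i, f, σ, hrest, -⟩ := ha
    obtain ⟨a, -, -, hperf⟩ := perform_wait (τ := τ) hrest
    rw [hperf]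
    simp [workLeft, hrest, List.countP_append]
    omega
  | reply k r =>
    obtain ⟨e, hk, hnone⟩ := ha
    rw [perform_reply hk]
    obtain ⟨hlt, hke⟩ := List.getElem?_eq_some_iff.mp hk
    have hpos : 0 < s.log.countP fun e => e.reply.isNone :=
      List.countP_pos_iff.mpr ⟨e, List.mem_of_getElem? hk, by simp [hnone]⟩
    simp [workLeft, List.countP_set hlt, hke, hnone]
    exact ⟨e, List.mem_of_getElem? hk, hnone⟩

/-- The print of the tracking adversary is correct. -/
lemma trackGuess_eq (hflat : τ.IsFlat g) (hf₀ : τ.Adj f₀ g)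
    (hinj : Set.InjOn φ (τ.nonInputs f₀)) (hφ : ∀ x ∈ τ.nonInputs f₀, τ.Adj x (φ x) ∧ φ x ≠ f₀)
    {G : τ.GlobalSession} {s : State N G.numUsers}
    (h : τ.Occurs (trackStrategy τ g f₀ φ) G s) {q q' : ViewEntry N}
    (hq : TrackFound g f₀ s.view q q') : ∃ i, trackGuess τ f₀ φ q q' = τ.toAssign (G.user i) := by
  classical
  obtain ⟨h1, h2, hqn, hqr, hqn', hqa⟩ := hq
  have hI := h.inv
  have hbit := h.bit_eq_trackReply
  simp only [State.view, List.mem_map] at h1 h2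
  obtain ⟨e, he, rfl⟩ := h1
  obtain ⟨e', he', rfl⟩ := h2
  dsimp only at hqn hqr hqn' hqa
  -- a query at a predecessor of the root of the user who made the query `e'` at the root
  have hpred : ∀ f, τ.Adj f g → ∃ k e₂, s.log[k]? = some e₂ ∧ e₂.user = e'.user ∧ e₂.node = f ∧
      s.mem e'.user f = some (trackReply τ f₀ φ (logQueries s) k) := by
    intro f hf
    have hmem := (G.isSchedule.mem_iff e'.user f).mpr (hflat.pred_not_mem_vars hf)
    obtain ⟨k, hk⟩ := List.mem_iff_getElem?.mp hmem
    obtain ⟨b, hb⟩ := Option.ne_none_iff_exists'.mp (hI.args_def e' he' f (hqn' ▸ hf))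
    have hbk := hI.mem_query k _ _ hk
    rw [hb] at hbk
    rw [hb, hbit k b hbk.symm]
    rw [view_bit] at hbk
    cases hlog : s.log[k]? with
    | none => rw [hlog] at hbk; simp at hbk
    | some e₂ =>
      rw [hI.getElem?_schedule hlog] at hk
      obtain ⟨h3, h4⟩ := Prod.mk.inj (Option.some.inj hk)
      exact ⟨k, e₂, hlog, h3, h4, rfl⟩
  have hfirst : ∀ {k e₂}, s.log[k]? = some e₂ → e₂.node = f₀ →
      trackReply τ f₀ φ (logQueries s) k = true → ∀ j < k, ∀ e₃, s.log[j]? = some e₃ →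
        e₃.node ≠ f₀ := by
    intro k e₂ hk hn ht j hj e₃ he₃
    simp only [trackReply, logQueries, List.getElem?_map, hk, Option.map_some, hn, if_true,
      decide_eq_true_eq] at ht
    exact ht j hj (e₃.node, e₃.args) (by rw [he₃]; rfl)
  -- the tagged query was made by the same user
  have huser : e.user = e'.user := by
    obtain ⟨k, e₂, hk, hu, hn, hm⟩ := hpred f₀ hf₀
    have ha := hI.args_eq e' he'
    rw [ha] at hqa
    dsimp only at hqa
    rw [if_pos (hqn' ▸ hf₀), hm] at hqa
    obtain ⟨k', hk'⟩ := List.mem_iff_getElem?.mp he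
    have ht' := (hbit k' true (by rw [view_bit, hk']; exact hqr)).symm
    have ht := Option.some.inj hqa
    rcases lt_trichotomy k k' with hlt | rfl | hgt
    · exact absurd hn (hfirst hk' hqn ht' k hlt e₂ hk)
    · rw [hk] at hk'
      rw [← hu, Option.some.inj hk']
    · exact absurd hqn (hfirst hk hn ht k' hgt e hk')
  refine ⟨e.user, funext fun u => ?_⟩
  by_cases hu : u ∈ τ.vars
  · simp only [trackGuess, toAssign, hu, if_true, dif_pos]
    split_ifs with hadj
    · rw [hI.args_eq e he]
      dsimp only
      rw [if_pos (hqn ▸ hadj), hI.mem_var _ _ hu]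
    · have hx : u ∈ τ.nonInputs f₀ := ⟨hu, hadj⟩
      obtain ⟨hadj', hne⟩ := hφ u hx
      have hg := hflat.adj_of_adj hu hadj'
      obtain ⟨k, e₂, hk, hu₂, hn, hm⟩ := hpred (φ u) hg
      rw [hI.args_eq e' he']
      dsimp only
      rw [if_pos (hqn' ▸ hg), hm]
      have hex : ∃ x ∈ τ.nonInputs f₀, φ x = φ u := ⟨u, hx, rfl⟩
      have hch : hex.choose = u := hinj hex.choose_spec.1 hx hex.choose_spec.2
      have harg : e₂.args u = some (G.user e.user ⟨u, hu⟩) := by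
        rw [hI.args_eq e₂ (List.mem_of_getElem? hk)]
        dsimp only
        rw [if_pos (hn ▸ hadj'), hI.mem_var _ _ hu, hu₂, huser]
      simp only [trackReply, logQueries, List.getElem?_map, hk, Option.map_some, hn, hne, if_false,
        dif_pos hex, hch, harg, Option.getD_some]
  · simp [trackGuess, toAssign, hu]

/-- The tracking adversary has found a user's queries at the end of a run. -/
lemma exists_trackFound (hflat : τ.IsFlat g) (hf₀ : τ.Adj f₀ g)
    {G : τ.GlobalSession} {s : State N G.numUsers}
    (h : τ.Occurs (trackStrategy τ g f₀ φ) G s) (hfin : s.Final) :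
    ∃ q q', TrackFound g f₀ s.view q q' := by
  classical
  have hI := h.inv
  have hlog : s.log.map (fun e => (e.user, e.node)) = G.schedule := by
    rw [← hI.sched, hfin.1, List.append_nil]
  have hmem : ∀ i f, f ∉ τ.vars → ∃ e ∈ s.log, e.user = i ∧ e.node = f := by
    intro i f hf
    have := (G.isSchedule.mem_iff i f).mpr hf
    rw [← hlog] at this
    obtain ⟨e, he, heq⟩ := List.mem_map.mp this
    exact ⟨e, he, Prod.mk.inj heq⟩
  have hex : ∃ k : ℕ, ∃ e : Entry N G.numUsers, s.log[k]? = some e ∧ e.node = f₀ := by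
    obtain ⟨e, he, -, hn⟩ := hmem ⟨0, G.numUsers_pos⟩ f₀ (hflat.pred_not_mem_vars hf₀)
    obtain ⟨k, hk⟩ := List.mem_iff_getElem?.mp he
    exact ⟨k, e, hk, hn⟩
  obtain ⟨e, hk, hn⟩ := Nat.find_spec hex
  have he := List.mem_of_getElem? hk
  obtain ⟨⟨b, t⟩, hb⟩ := Option.ne_none_iff_exists'.mp (hfin.2 e he)
  have htrue : b = true := by
    have := h.bit_eq_trackReply (Nat.find hex) b (by rw [view_bit, hk, Option.bind_some, hb]; rfl)
    rw [this]
    simp only [trackReply, logQueries, List.getElem?_map, hk, Option.map_some, hn, if_true,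
      decide_eq_true_eq]
    intro j hj q hq
    obtain ⟨e₂, he₂, rfl⟩ := Option.map_eq_some_iff.mp hq
    exact fun hn₂ => Nat.find_min hex hj ⟨e₂, he₂, hn₂⟩
  subst htrue
  obtain ⟨e', he', hu', hn'⟩ := hmem e.user g hflat.root_not_mem_vars
  refine ⟨⟨e.node, e.args, e.reply⟩, ⟨e'.node, e'.args, e'.reply⟩,
    List.mem_map.mpr ⟨e, he, rfl⟩, List.mem_map.mpr ⟨e', he', rfl⟩, hn, by simp [hb], hn', ?_⟩
  dsimp only
  rw [hI.args_eq e' he']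
  dsimp only
  rw [if_pos (hn' ▸ hf₀), hu', ← hn, hI.mem_of_log he, hb]
  rfl

lemma trackStrategy_wins (hflat : τ.IsFlat g) (hf₀ : τ.Adj f₀ g)
    (hinj : Set.InjOn φ (τ.nonInputs f₀)) (hφ : ∀ x ∈ τ.nonInputs f₀, τ.Adj x (φ x) ∧ φ x ≠ f₀)
    (G : τ.GlobalSession) : τ.Wins (trackStrategy τ g f₀ φ) G := by
  suffices H : ∀ n (s : State N G.numUsers), workLeft s = n →
      τ.Occurs (trackStrategy τ g f₀ φ) G s → τ.Wins (trackStrategy τ g f₀ φ) G from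
    H _ _ rfl .start
  intro n
  induction n using Nat.strong_induction_on with
  | _ n ih =>
    intro s hs hocc
    by_cases hprint : ∃ q q', TrackFound g f₀ s.view q q'
    · obtain ⟨i, hi⟩ := trackGuess_eq hflat hf₀ hinj hφ hocc hprint.choose_spec.choose_spec
      exact ⟨s, hocc, i, by rw [trackStrategy, dif_pos hprint, hi]⟩
    · have hav := trackStrategy_available (g := g) (f₀ := f₀) (φ := φ) hocc.inv
        (fun hfin => hprint (exists_trackFound hflat hf₀ hocc hfin))
      have hnp : ∀ I, trackStrategy τ g f₀ φ s.view ≠ .print I := by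
        intro I
        rw [trackStrategy, dif_neg hprint]
        split_ifs <;> simp
      exact ih _ (hs ▸ workLeft_perform hav hnp) _ rfl (.step s hocc hnp hav)

end Adversary

theorem IsFlat.insecure_of_tracking (hflat : τ.IsFlat g) {T : Set N}
    (hT : τ.IsTrackingStrategy T) : τ.Insecure := by
  obtain ⟨f₀, hf₀, φ, hinj, hφ⟩ := hflat.exists_matching hT
  exact ⟨trackStrategy τ g f₀ φ, fun G s h hfin => trackStrategy_available h.inv hfin,
    trackStrategy_wins hflat hf₀ hinj hφ⟩

end Protocol
namespace Protocol

variable {N : Type*} {τ : Protocol N} {g : N} {m : ℕ}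

/-! ### Indistinguishable runs -/

lemma Inv.getElem?_length {G : τ.GlobalSession} {s : State N G.numUsers} (h : Inv G s)
    {p : Fin G.numUsers × N} {l : List (Fin G.numUsers × N)} (hr : s.rest = p :: l) :
    G.schedule[s.log.length]? = some p := by
  rw [← h.sched, List.getElem?_append_right (by simp), hr]
  simp

lemma length_eq_of_view_eq {s s' : State N m} (hv : s.view = s'.view) :
    s.log.length = s'.log.length := by
  simpa [State.view] using congrArg (fun w => w.queries.length) hv

lemma exists_of_view_eq {s s' : State N m} (hv : s.view = s'.view) {k : ℕ} {e : Entry N m}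
    (hk : s.log[k]? = some e) : ∃ e', s'.log[k]? = some e' ∧ e'.node = e.node ∧
      e'.args = e.args ∧ e'.reply = e.reply := by
  have h := congrArg (fun w => w.queries[k]?) hv
  simp only [State.view, List.getElem?_map, hk, Option.map_some] at h
  obtain ⟨e', he', h'⟩ := Option.map_eq_some_iff.mp h.symm
  simp only [ViewEntry.mk.injEq] at h'
  exact ⟨e', he', h'⟩

/-- The same action leads from states with equal views to states with equal views, provided that the
next queries have equal arguments. -/
lemma perform_congr {s s' : State N m} (hv : s.view = s'.view) (ht : s.time = s'.time)
    {a : Action N} (ha : τ.Available s a) (ha' : τ.Available s' a)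
    (hargs : a = .wait → ∀ i f l i' f' l', s.rest = (i, f) :: l → s'.rest = (i', f') :: l' →
      f = f' ∧ ∀ u, τ.Adj u f → s.mem i u = s'.mem i' u) :
    (τ.perform s a).view = (τ.perform s' a).view ∧
      (τ.perform s a).time = (τ.perform s' a).time := by
  have hq : s.log.map (fun e => (⟨e.node, e.args, e.reply⟩ : ViewEntry N)) =
      s'.log.map fun e => ⟨e.node, e.args, e.reply⟩ := congrArg View.queries hv
  cases a with
  | print I => exact ⟨hv, ht⟩
  | wait =>
    obtain ⟨i, f, l, hr, -⟩ := ha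
    obtain ⟨i', f', l', hr', -⟩ := ha'
    obtain ⟨rfl, hmem⟩ := hargs rfl i f l i' f' l' hr hr'
    obtain ⟨a, h1, h2, h3⟩ := perform_wait (τ := τ) hr
    obtain ⟨a', h1', h2', h3'⟩ := perform_wait (τ := τ) hr'
    have haa : a = a' := by
      funext u
      by_cases hu : τ.Adj u f
      · rw [h1 u hu, h1' u hu, hmem u hu]
      · rw [h2 u hu, h2' u hu]
    rw [h3, h3', ht, haa]
    simp [State.view, hq]
  | reply k r =>
    obtain ⟨e, hk, -⟩ := ha
    obtain ⟨e', hk', h1, h2, h3⟩ := exists_of_view_eq hv hk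
    rw [perform_reply hk, perform_reply hk', ht]
    simp [State.view, List.map_set, hq, h1, h2]

lemma available_of_view_eq {P : Strategy N} {s s' : State N m} (hv : s.view = s'.view)
    (hlen : s.rest.length = s'.rest.length) (hadm : ¬ s'.Final → τ.Available s' (P s'.view))
    (ha : τ.Available s (P s.view)) : τ.Available s' (P s'.view) := by
  by_cases hfin : s'.Final
  · rw [← hv]
    cases hP : P s.view with
    | print I => trivial
    | wait =>
      rw [hP] at ha
      obtain ⟨i, f, l, hr, -⟩ := ha
      rw [hr, hfin.1] at hlen
      cases hlen
    | reply k r =>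
      rw [hP] at ha
      obtain ⟨e, hk, hn⟩ := ha
      obtain ⟨e', hk', -, -, h3⟩ := exists_of_view_eq hv hk
      exact ⟨e', hk', h3.trans hn⟩
  · exact hadm hfin

/-! ### Global sessions in two phases -/

/-- The fixed data of the two-phase global sessions of a flat protocol for `m` users: an
enumeration of the predecessors of the root. -/
structure Frame (τ : Protocol N) (g : N) (m : ℕ) where
  flat : τ.IsFlat g
  queries : List N
  nodup : queries.Nodup
  mem_queries : ∀ f, f ∈ queries ↔ τ.Adj f g
  numUsers_pos : 0 < m

/-- Local sessions of `m` users, together with the order in which they make their queries: the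
`w`-th query at `f` is made by the user `user f w`, and the `t`-th query at the root by the user
`last t`. -/
structure Phased (τ : Protocol N) (m : ℕ) where
  session : Fin m → τ.LocalSession
  user : N → Equiv.Perm (Fin m)
  last : Equiv.Perm (Fin m)

namespace Frame

variable (C : Frame τ g m)

/-- The order of the queries in the first phase, as pairs of a node and the number of the query
at that node. -/
def slots : List (N × Fin m) := C.queries ×ˢ List.finRange m

/-- First all queries at the predecessors of the root are made, then those at the root. -/
def schedule (X : Phased τ m) : List (Fin m × N) :=
  C.slots.map (fun p => (X.user p.1 p.2, p.1)) ++ (List.finRange m).map fun t => (X.last t, g)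

lemma root_not_mem : g ∉ C.queries := fun h =>
  τ.acyclic g (.single ((C.mem_queries g).mp h))

lemma mem_slots {f : N} {w : Fin m} : (f, w) ∈ C.slots ↔ f ∈ C.queries := by
  simp [slots, List.mem_product]

lemma isSchedule (X : Phased τ m) : τ.IsSchedule m (C.schedule X) where
  nodup := by
    refine List.Nodup.append ?_ ?_ ?_
    · refine List.Nodup.map ?_ (List.Nodup.product C.nodup (List.nodup_finRange m))
      rintro ⟨f, w⟩ ⟨f', w'⟩ h
      simp only [Prod.mk.injEq] at h
      obtain ⟨h1, rfl⟩ := h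
      rw [(X.user f).injective h1]
    · refine List.Nodup.map ?_ (List.nodup_finRange m)
      intro t t' h
      exact X.last.injective (Prod.mk.inj h).1
    · intro p hp hp'
      obtain ⟨⟨f, w⟩, hq, rfl⟩ := List.mem_map.mp hp
      obtain ⟨t, -, ht⟩ := List.mem_map.mp hp'
      apply C.root_not_mem
      have hfg : g = f := (Prod.mk.inj ht).2
      have hf := C.mem_slots.mp hq
      rwa [← hfg] at hf
  mem_iff := by
    intro i f
    simp only [schedule, List.mem_append, List.mem_map, Prod.mk.injEq, List.mem_finRange, true_and]
    constructor
    · rintro (⟨⟨f', w⟩, hq, -, rfl⟩ | ⟨t, -, rfl⟩)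
      · exact C.flat.pred_not_mem_vars ((C.mem_queries _).mp (C.mem_slots.mp hq))
      · exact C.flat.root_not_mem_vars
    · intro hf
      by_cases hfg : f = g
      · exact .inr ⟨X.last.symm i, by simp, hfg.symm⟩
      · exact .inl ⟨(f, (X.user f).symm i),
          C.mem_slots.mpr ((C.mem_queries f).mpr (C.flat.adj_root hf hfg)), by simp, rfl⟩
  order := by
    intro i f w hf hadj
    obtain rfl : w = g := (C.flat.form f w hadj).elim (fun h => absurd h.1 hf) And.right
    rw [schedule, show [(i, f), (i, w)] = [(i, f)] ++ [(i, w)] from rfl]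
    refine List.Sublist.append ?_ ?_
    · exact List.singleton_sublist.mpr (List.mem_map.mpr ⟨(f, (X.user f).symm i),
        C.mem_slots.mpr ((C.mem_queries f).mpr hadj), by simp⟩)
    · exact List.singleton_sublist.mpr (List.mem_map.mpr ⟨X.last.symm i, by simp, by simp⟩)

/-- The two-phase global session. -/
def global (X : Phased τ m) : τ.GlobalSession where
  numUsers := m
  numUsers_pos := C.numUsers_pos
  user := X.session
  schedule := C.schedule X
  isSchedule := C.isSchedule X

/-- The state of the run for a two-phase session after at most `n` actions. -/
def stateAt (P : Strategy N) (X : Phased τ m) (n : ℕ) : State N m := run P (C.global X) n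

variable {C} {P : Strategy N} {X Y : Phased τ m} {n : ℕ}

lemma schedule_length : (C.schedule X).length = C.slots.length + m := by simp [schedule]

lemma inv_stateAt : Inv (C.global X) (C.stateAt P X n) := inv_run n

lemma length_add_length :
    (C.stateAt P X n).log.length + (C.stateAt P X n).rest.length = C.slots.length + m := by
  have h := congrArg List.length (inv_stateAt (C := C) (P := P) (X := X) (n := n)).sched
  rw [List.length_append, List.length_map] at h
  exact h.trans schedule_length

open scoped Classical in
/-- The position of a query of the first phase in the schedule. -/
def pos (C : Frame τ g m) (f : N) (w : Fin m) : ℕ := C.slots.idxOf (f, w)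

lemma pos_lt {f : N} (hf : τ.Adj f g) (w : Fin m) : C.pos f w < C.slots.length := by
  classical
  exact List.idxOf_lt_length_of_mem (C.mem_slots.mpr ((C.mem_queries f).mpr hf))

lemma getElem?_schedule_pos {f : N} (hf : τ.Adj f g) (w : Fin m) :
    (C.schedule X)[C.pos f w]? = some (X.user f w, f) := by
  classical
  rw [schedule, List.getElem?_append_left (by simpa using pos_lt hf w), List.getElem?_map,
    List.getElem?_eq_getElem (pos_lt hf w)]
  simp [pos]

lemma mem_user {f : N} (hf : τ.Adj f g) (w : Fin m) :
    (C.stateAt P X n).mem (X.user f w) f = (C.stateAt P X n).view.bit (C.pos f w) :=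
  inv_stateAt.mem_query _ _ _ (getElem?_schedule_pos hf w)

lemma mem_session (i : Fin m) {x : N} (hx : x ∈ τ.vars) :
    (C.stateAt P X n).mem i x = some (X.session i ⟨x, hx⟩) :=
  inv_stateAt.mem_var i x hx

/-- The two runs are indistinguishable for the adversary up to the `n`-th action. -/
def Indist (C : Frame τ g m) (P : Strategy N) (X Y : Phased τ m) (n : ℕ) : Prop :=
  (C.stateAt P X n).view = (C.stateAt P Y n).view ∧ (C.stateAt P X n).time = (C.stateAt P Y n).time

lemma indist_zero : Indist C P X Y 0 := ⟨rfl, rfl⟩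

lemma Indist.available_iff (h : Indist C P X Y n) (hP : τ.Admissible P) :
    τ.Available (C.stateAt P X n) (P (C.stateAt P X n).view) ↔
      τ.Available (C.stateAt P Y n) (P (C.stateAt P Y n).view) := by
  have h1 := length_add_length (C := C) (P := P) (X := X) (n := n)
  have h2 := length_add_length (C := C) (P := P) (X := Y) (n := n)
  have h3 := length_eq_of_view_eq h.1
  exact ⟨available_of_view_eq h.1 (by omega) (hP (C.global Y) _ (occurs_run n)),
    available_of_view_eq h.1.symm (by omega) (hP (C.global X) _ (occurs_run n))⟩

lemma stateAt_succ_pos (hp : ∀ I, P (C.stateAt P X n).view ≠ .print I)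
    (ha : τ.Available (C.stateAt P X n) (P (C.stateAt P X n).view)) :
    C.stateAt P X (n + 1) = τ.perform (C.stateAt P X n) (P (C.stateAt P X n).view) :=
  if_pos ⟨hp, ha⟩

lemma stateAt_succ_neg (h : ¬ ((∀ I, P (C.stateAt P X n).view ≠ .print I) ∧
    τ.Available (C.stateAt P X n) (P (C.stateAt P X n).view))) :
    C.stateAt P X (n + 1) = C.stateAt P X n :=
  if_neg h

/-- Runs remain indistinguishable if the next queries have equal arguments. -/
lemma Indist.succ (h : Indist C P X Y n) (hP : τ.Admissible P)
    (hargs : P (C.stateAt P X n).view = .wait → τ.Available (C.stateAt P X n) .wait →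
      τ.Available (C.stateAt P Y n) .wait → ∀ i f i' f',
      (C.schedule X)[(C.stateAt P X n).log.length]? = some (i, f) →
      (C.schedule Y)[(C.stateAt P X n).log.length]? = some (i', f') →
      f = f' ∧ ∀ u, τ.Adj u f → (C.stateAt P X n).mem i u = (C.stateAt P Y n).mem i' u) :
    Indist C P X Y (n + 1) := by
  by_cases hp : (∀ I, P (C.stateAt P X n).view ≠ .print I) ∧
      τ.Available (C.stateAt P X n) (P (C.stateAt P X n).view)
  · have hav := (h.available_iff hP).mp hp.2
    rw [Indist, stateAt_succ_pos hp.1 hp.2, stateAt_succ_pos (by rw [← h.1]; exact hp.1) hav]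
    rw [← h.1] at hav ⊢
    refine perform_congr h.1 h.2 hp.2 hav fun hw i f l i' f' l' hr hr' => ?_
    refine hargs hw (hw ▸ hp.2) (hw ▸ hav) i f i' f' (inv_stateAt.getElem?_length hr) ?_
    rw [length_eq_of_view_eq h.1]
    exact inv_stateAt.getElem?_length hr'
  · rw [Indist, stateAt_succ_neg hp, stateAt_succ_neg]
    · exact h
    · rw [← h.available_iff hP, ← h.1]; exact hp

/-- In both sessions the same queries are made in the first phase. -/
def Compatible (g : N) (X Y : Phased τ m) : Prop :=
  ∀ f, τ.Adj f g → ∀ w x (hx : x ∈ τ.vars), τ.Adj x f →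
    X.session (X.user f w) ⟨x, hx⟩ = Y.session (Y.user f w) ⟨x, hx⟩

/-- The arguments of the next query, if it belongs to the first phase. -/
lemma args_first (hXY : Compatible g X Y)
    (hn : (C.stateAt P X n).log.length < C.slots.length) (i : Fin m) (f : N) (i' : Fin m) (f' : N)
    (hi : (C.schedule X)[(C.stateAt P X n).log.length]? = some (i, f))
    (hi' : (C.schedule Y)[(C.stateAt P X n).log.length]? = some (i', f')) :
    f = f' ∧ ∀ u, τ.Adj u f → (C.stateAt P X n).mem i u = (C.stateAt P Y n).mem i' u := by
  rw [schedule, List.getElem?_append_left (by simpa using hn), List.getElem?_map,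
    List.getElem?_eq_getElem hn, Option.map_some] at hi hi'
  obtain ⟨rfl, rfl⟩ := Prod.mk.inj (Option.some.inj hi)
  obtain ⟨rfl, rfl⟩ := Prod.mk.inj (Option.some.inj hi')
  refine ⟨rfl, fun u hu => ?_⟩
  have hf : τ.Adj (C.slots[(C.stateAt P X n).log.length]).1 g :=
    (C.mem_queries _).mp (C.mem_slots.mp (List.getElem_mem hn))
  have hx := C.flat.mem_vars_of_adj hf hu
  rw [mem_session _ hx, mem_session _ hx]
  exact congrArg some (hXY _ hf _ u hx hu)

/-- In the first phase, runs for compatible sessions are indistinguishable. -/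
lemma indist_first (hP : τ.Admissible P) (hXY : Compatible g X Y)
    (hn : (C.stateAt P X n).log.length ≤ C.slots.length) : Indist C P X Y n := by
  induction n with
  | zero => exact indist_zero
  | succ n ih =>
    have hle : (C.stateAt P X n).log.length ≤ C.slots.length :=
      (run_length_mono (n.le_succ)).trans hn
    refine (ih hle).succ hP fun hw ha _ i f i' f' hi hi' => args_first hXY ?_ i f i' f' hi hi'
    obtain ⟨j, f, l, hr, -⟩ := id ha
    rw [stateAt_succ_pos (by simp [hw]) (by rwa [hw]), hw] at hn
    obtain ⟨a, -, -, hp⟩ := perform_wait (τ := τ) hr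
    rw [hp] at hn
    simpa using hn

/-- The adversary can leave the first phase only when all its queries have been answered: any user
might be the next one. -/
lemma answered_of_wait (hP : τ.Admissible P)
    (hn : (C.stateAt P X n).log.length = C.slots.length) (hw : P (C.stateAt P X n).view = .wait)
    {f : N} (hf : τ.Adj f g) (w : Fin m) : (C.stateAt P X n).view.bit (C.pos f w) ≠ none := by
  -- the user in question makes the first query of the second phase
  let Y : Phased τ m := { X with last := Equiv.swap ⟨0, C.numUsers_pos⟩ (X.user f w) }
  have hY : Indist C P X Y n := indist_first hP (fun _ _ _ _ _ _ => rfl) hn.le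
  have hlen := length_add_length (C := C) (P := P) (X := Y) (n := n)
  have hlen' := length_eq_of_view_eq hY.1
  have hm := C.numUsers_pos
  have hav : τ.Available (C.stateAt P Y n) (P (C.stateAt P Y n).view) := by
    refine hP (C.global Y) _ (occurs_run n) fun hfin => ?_
    have : (C.stateAt P Y n).rest.length = 0 := List.length_eq_zero_iff.mpr hfin.1
    omega
  rw [← hY.1, hw] at hav
  obtain ⟨i, f', l, hr, hdef⟩ := hav
  have hnext : (C.schedule Y)[(C.stateAt P Y n).log.length]? = some (i, f') :=
    inv_stateAt.getElem?_length hr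
  rw [← hlen', hn, schedule, List.getElem?_append_right (by simp), List.length_map, Nat.sub_self,
    List.getElem?_map, List.getElem?_eq_getElem (by simpa using hm), Option.map_some] at hnext
  obtain ⟨rfl, rfl⟩ := Prod.mk.inj (Option.some.inj hnext)
  have hlast : Y.last ((List.finRange m)[0]'(by simpa using hm)) = Y.user f w := by
    rw [List.getElem_finRange]
    exact Equiv.swap_apply_left _ _
  have := hdef f hf
  rwa [hlast, mem_user hf, ← hY.1] at this

/-- Once the second phase has been entered, all queries of the first phase are answered. -/
lemma answered_of_lt (hP : τ.Admissible P)
    (hn : C.slots.length < (C.stateAt P X n).log.length) {f : N} (hf : τ.Adj f g) (w : Fin m) :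
    ∃ k ≤ n, (C.stateAt P X k).log.length ≤ C.slots.length ∧
      (C.stateAt P X k).view.bit (C.pos f w) ≠ none := by
  induction n with
  | zero => exact absurd hn (Nat.not_lt_zero _)
  | succ n ih =>
    rcases lt_or_ge C.slots.length (C.stateAt P X n).log.length with hlt | hle
    · obtain ⟨k, hk, h⟩ := ih hlt
      exact ⟨k, hk.trans n.le_succ, h⟩
    · refine ⟨n, n.le_succ, hle, ?_⟩
      by_cases hp : (∀ I, P (C.stateAt P X n).view ≠ .print I) ∧
          τ.Available (C.stateAt P X n) (P (C.stateAt P X n).view)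
      · rw [stateAt_succ_pos hp.1 hp.2] at hn
        cases hw : P (C.stateAt P X n).view with
        | print I => exact absurd hw (hp.1 I)
        | wait =>
          rw [hw] at hn hp
          obtain ⟨i, f, l, hr, -⟩ := hp.2
          obtain ⟨a, -, -, hperf⟩ := perform_wait (τ := τ) hr
          rw [hperf] at hn
          simp only [List.length_append, List.length_singleton] at hn
          exact answered_of_wait hP (by omega) hw hf w
        | reply k r =>
          rw [hw] at hn hp
          obtain ⟨e, hk, -⟩ := hp.2
          rw [perform_reply hk] at hn
          simp only [List.length_set] at hn
          omega
      · rw [stateAt_succ_neg hp] at hn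
        omega

/-- The replies of the first phase depend only on its queries. -/
theorem exists_replies (hP : τ.Admissible P) (Z : Phased τ m) : ∃ r : N → Fin m → Bool,
    ∀ X, Compatible g X Z → ∀ n f, τ.Adj f g → ∀ w b,
      (C.stateAt P X n).view.bit (C.pos f w) = some b → b = r f w := by
  classical
  refine ⟨fun f w => decide (∃ n, (C.stateAt P Z n).log.length ≤ C.slots.length ∧
    (C.stateAt P Z n).view.bit (C.pos f w) = some true), fun X hX => ?_⟩
  have first : ∀ n f, τ.Adj f g → ∀ w b, (C.stateAt P X n).log.length ≤ C.slots.length →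
      (C.stateAt P X n).view.bit (C.pos f w) = some b →
      b = decide (∃ n, (C.stateAt P Z n).log.length ≤ C.slots.length ∧
        (C.stateAt P Z n).view.bit (C.pos f w) = some true) := by
    intro n f hf w b hn hb
    have hi := indist_first hP hX hn
    rw [length_eq_of_view_eq hi.1] at hn
    rw [hi.1] at hb
    cases b with
    | true => exact (decide_eq_true ⟨n, hn, hb⟩).symm
    | false =>
      refine (decide_eq_false ?_).symm
      rintro ⟨n', -, hn'⟩
      rcases le_total n n' with h | h
      · have := (bit_run_mono h hb).symm.trans hn'
        cases this
      · have := (bit_run_mono h hn').symm.trans hb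
        cases this
  intro n f hf w b hb
  rcases le_or_gt (C.stateAt P X n).log.length C.slots.length with hle | hlt
  · exact first n f hf w b hle hb
  · obtain ⟨k, hk, hlen, hans⟩ := answered_of_lt hP hlt hf w
    obtain ⟨b', hb'⟩ := Option.ne_none_iff_exists'.mp hans
    have := (bit_run_mono hk hb').symm.trans hb
    rw [← Option.some.inj this]
    exact first k f hf w b' hlen hb'

/-- If in two compatible sessions every user obtains the same replies in the first phase, then the
whole runs are indistinguishable. -/
theorem indist_of_replies (hP : τ.Admissible P) {r : N → Fin m → Bool}
    (hXY : Compatible g X Y) (hlast : X.last = Y.last)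
    (hrX : ∀ n f, τ.Adj f g → ∀ w b,
      (C.stateAt P X n).view.bit (C.pos f w) = some b → b = r f w)
    (hrY : ∀ n f, τ.Adj f g → ∀ w b,
      (C.stateAt P Y n).view.bit (C.pos f w) = some b → b = r f w)
    (hr : ∀ f, τ.Adj f g → ∀ i, r f ((X.user f).symm i) = r f ((Y.user f).symm i)) (n : ℕ) :
    Indist C P X Y n := by
  induction n with
  | zero => exact indist_zero
  | succ n ih =>
    refine ih.succ hP fun hw ha ha' i f i' f' hi hi' => ?_
    rcases lt_or_ge (C.stateAt P X n).log.length C.slots.length with hlt | hge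
    · exact args_first hXY hlt i f i' f' hi hi'
    · obtain ⟨j, v, l, hrest, hdef⟩ := ha
      obtain ⟨j', v', l', hrest', hdef'⟩ := ha'
      have h1 : (C.schedule X)[(C.stateAt P X n).log.length]? = some (j, v) :=
        inv_stateAt.getElem?_length hrest
      have h2 : (C.schedule Y)[(C.stateAt P Y n).log.length]? = some (j', v') :=
        inv_stateAt.getElem?_length hrest'
      rw [← length_eq_of_view_eq ih.1] at h2
      obtain ⟨rfl, rfl⟩ := Prod.mk.inj (Option.some.inj (hi.symm.trans h1))
      obtain ⟨rfl, rfl⟩ := Prod.mk.inj (Option.some.inj (hi'.symm.trans h2))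
      rw [schedule, List.getElem?_append_right (by simpa using hge), List.getElem?_map] at hi hi'
      obtain ⟨t, ht, heq⟩ := Option.map_eq_some_iff.mp hi
      obtain ⟨t', ht', heq'⟩ := Option.map_eq_some_iff.mp hi'
      rw [List.length_map] at ht ht'
      obtain rfl := Option.some.inj (ht.symm.trans ht')
      obtain ⟨rfl, rfl⟩ := Prod.mk.inj heq
      obtain ⟨rfl, rfl⟩ := Prod.mk.inj heq'
      refine ⟨rfl, fun u hu => ?_⟩
      rw [← hlast] at hdef' ⊢
      obtain ⟨b, hb⟩ := Option.ne_none_iff_exists'.mp (hdef u hu)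
      obtain ⟨b', hb'⟩ := Option.ne_none_iff_exists'.mp (hdef' u hu)
      rw [hb, hb']
      rw [← (X.user u).apply_symm_apply (X.last t), mem_user hu] at hb
      rw [← (Y.user u).apply_symm_apply (X.last t), mem_user hu] at hb'
      rw [hrX n u hu _ b hb, hrY n u hu _ b' hb', hr u hu]

/-- In indistinguishable runs the adversary prints the same. -/
lemma print_unique (h : ∀ n, Indist C P X Y n) {k k' : ℕ} {I I' : Assign N}
    (hI : P (C.stateAt P X k).view = .print I) (hI' : P (C.stateAt P Y k').view = .print I') :
    I = I' := by
  rcases le_total k k' with hk | hk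
  · have h1 : C.stateAt P X k' = C.stateAt P X k := run_of_print hI hk
    rw [← (h k').1, h1, hI] at hI'
    exact Action.print.inj hI'
  · have h1 : C.stateAt P Y k = C.stateAt P Y k' := run_of_print hI' hk
    rw [(h k).1, h1, hI'] at hI
    exact (Action.print.inj hI).symm

end Frame

end Protocol
namespace Protocol

variable {N : Type*} {τ : Protocol N} {g : N} {m : ℕ}

/-! ### Security without tracking strategies -/

lemma toAssign_injective : Function.Injective τ.toAssign := by
  intro I J h
  funext x
  have := congrFun h x.1
  simpa [toAssign, x.2] using this

/-- If only the designated private variables of other nodes are not inputs of `f₀`, then `f₀`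
and the root form a tracking strategy. -/
lemma IsFlat.isTrackingStrategy (hflat : τ.IsFlat g) {priv : {f // τ.Adj f g} → τ.vars}
    (hadj : ∀ f, τ.Adj (priv f) f) (f₀ : {f // τ.Adj f g})
    (h : ∀ x : τ.vars, (∀ f, x ≠ priv f) → τ.Adj x f₀) : τ.IsTrackingStrategy {f₀.1, g} := by
  classical
  have hpath : ∀ x : τ.vars, ∃ p : List N, (τ.IsPath p ∧ p.head? = some x.1 ∧
      ∃ t ∈ ({f₀.1, g} : Set N), p.getLast? = some t) ∧
      ∀ v ∈ p, v ∈ ({f₀.1, g} : Set N) ∨ v = x.1 ∨ ∃ f, v = f.1 ∧ x = priv f := by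
    intro x
    by_cases hx : τ.Adj x f₀
    · refine ⟨[x.1, f₀.1], ⟨⟨by simp, by simpa using hx⟩, rfl, f₀.1, by simp, rfl⟩, ?_⟩
      simp
    · obtain ⟨f, rfl⟩ : ∃ f, x = priv f := by
        by_contra hcon
        exact hx (h x (not_exists.mp hcon))
      refine ⟨[(priv f).1, f.1, g], ⟨⟨by simp, by simpa using ⟨hadj f, f.2⟩⟩, rfl, g, by simp,
        rfl⟩, ?_⟩
      intro v hv
      simp only [List.mem_cons, List.not_mem_nil, or_false] at hv
      rcases hv with rfl | rfl | rfl
      · exact .inr (.inl rfl)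
      · exact .inr (.inr ⟨f, rfl, rfl⟩)
      · exact .inl (by simp)
  choose p hp hnodes using hpath
  refine ⟨?_, ⟨f₀.1, by simp, ?_⟩, p, hp, ?_⟩
  · rintro t (rfl | rfl)
    · exact hflat.pred_not_mem_vars f₀.2
    · exact hflat.root_not_mem_vars
  · rintro u (rfl | rfl)
    · exact .refl
    · exact .single f₀.2
  · intro x y hxy v hvx hvy
    rcases hnodes x v hvx with h1 | h1 | ⟨f, h1, h1'⟩
    · exact h1
    · rcases hnodes y v hvy with h2 | h2 | ⟨f', h2, -⟩
      · exact h2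
      · exact absurd (Subtype.ext (h1.symm.trans h2)) hxy
      · exact absurd (h2 ▸ h1 ▸ x.2) (hflat.pred_not_mem_vars f'.2)
    · rcases hnodes y v hvy with h2 | h2 | ⟨f', h2, h2'⟩
      · exact h2
      · exact absurd (h1 ▸ h2 ▸ y.2) (hflat.pred_not_mem_vars f.2)
      · exact absurd (by rw [h1', h2', Subtype.ext (h1.symm.trans h2)]) hxy

section

variable (priv : {f // τ.Adj f g} → τ.vars)

/-- The variables that are not designated private variables. -/
abbrev Shared : Type _ := {x : τ.vars // ∀ f, x ≠ priv f}

/-- The shared inputs of `f`. -/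
def sharedInputs (f : {f // τ.Adj f g}) : Set (Shared priv) := {x | τ.Adj x.1 f}

variable {priv} (d : {f // τ.Adj f g} → Shared priv)

open scoped Classical in
/-- The local session of the user at the vertex `v`: the designated private variable of `f` has
the value in direction `d f` of the user's instance of `f`. -/
def sessionAt (L : Relinking {f // τ.Adj f g} (Shared priv) (sharedInputs priv))
    (v : Shared priv → Bool) : τ.LocalSession := fun x =>
  if h : ∃ f, x = priv f then L.inst h.choose v (d h.choose)
  else L.vertex v ⟨x, not_exists.mp h⟩

variable {d}

lemma sessionAt_priv (hinj : Function.Injective priv)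
    (L : Relinking {f // τ.Adj f g} (Shared priv) (sharedInputs priv)) (v : Shared priv → Bool)
    (f : {f // τ.Adj f g}) : sessionAt d L v (priv f) = L.inst f v (d f) := by
  have h : ∃ f', priv f = priv f' := ⟨f, rfl⟩
  rw [sessionAt, dif_pos h, ← hinj h.choose_spec]

lemma sessionAt_shared (L : Relinking {f // τ.Adj f g} (Shared priv) (sharedInputs priv))
    (v : Shared priv → Bool) (x : Shared priv) : sessionAt d L v x.1 = L.vertex v x := by
  rw [sessionAt, dif_neg (not_exists.mpr x.2)]

variable (d)

open scoped Classical in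
/-- The two-phase sessions given by a linking. -/
def phasedAt (e : (Shared priv → Bool) ≃ Fin m)
    (L : Relinking {f // τ.Adj f g} (Shared priv) (sharedInputs priv)) : Phased τ m where
  session := fun i => sessionAt d L (e.symm i)
  user := fun f => if hf : τ.Adj f g then (e.symm.trans (L.inst ⟨f, hf⟩).symm).trans e else 1
  last := 1

variable {d}

lemma phasedAt_compatible (hinj : Function.Injective priv)
    (hpriv : ∀ f f' : {f // τ.Adj f g}, τ.Adj (priv f) f' → f = f')
    (e : (Shared priv → Bool) ≃ Fin m)
    (L L' : Relinking {f // τ.Adj f g} (Shared priv) (sharedInputs priv)) :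
    Frame.Compatible g (phasedAt d e L) (phasedAt d e L') := by
  classical
  have key : ∀ (L : Relinking {f // τ.Adj f g} (Shared priv) (sharedInputs priv)) f
      (hf : τ.Adj f g) w (x : τ.vars), τ.Adj x f →
      (phasedAt d e L).session ((phasedAt d e L).user f w) x =
        if h : ∃ f', x = priv f' then e.symm w (d ⟨f, hf⟩)
        else e.symm w ⟨x, not_exists.mp h⟩ := by
    intro L f hf w x hx
    simp only [phasedAt, hf, dif_pos, Equiv.trans_apply, Equiv.symm_apply_apply]
    split_ifs with h
    · obtain ⟨f', rfl⟩ := h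
      obtain rfl := hpriv f' ⟨f, hf⟩ hx
      rw [sessionAt_priv hinj, Equiv.apply_symm_apply]
    · rw [sessionAt_shared L _ ⟨x, not_exists.mp h⟩, ← L.agree ⟨f, hf⟩ _ ⟨x, not_exists.mp h⟩ hx,
        Equiv.apply_symm_apply]
  intro f hf w x hx hadj
  rw [key L f hf w ⟨x, hx⟩ hadj, key L' f hf w ⟨x, hx⟩ hadj]

end

theorem IsFlat.exists_tracking [Finite N] (hflat : τ.IsFlat g)
    (hpriv : ∀ f, τ.Adj f g → τ.HasPrivateVariable g f) (hins : τ.Insecure) :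
    ∃ T, τ.IsTrackingStrategy T := by
  classical
  have := Fintype.ofFinite N
  by_contra hno
  have hex : ∀ f : {f // τ.Adj f g}, ∃ x : τ.vars, τ.Adj x f ∧
      ∀ f' : {f // τ.Adj f g}, τ.Adj x f' → f = f' := by
    rintro ⟨f, hf⟩
    obtain ⟨x, hx, hxf, huniq⟩ := hpriv f hf
    refine ⟨⟨x, hx⟩, hxf, fun f' hadj => ?_⟩
    by_contra hne
    exact huniq f' f'.2 (fun h => hne (Subtype.ext h.symm)) hadj
  choose priv hadj hpriv' using hex
  have hinj : Function.Injective priv := fun f f' h => hpriv' f f' (h ▸ hadj f')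
  have hd : ∀ f : {f // τ.Adj f g}, ∃ s : Shared priv, s ∉ sharedInputs priv f := by
    intro f
    by_contra hcon
    refine hno ⟨_, hflat.isTrackingStrategy hadj f fun x hx => ?_⟩
    by_contra hx'
    exact hcon ⟨⟨x, hx⟩, hx'⟩
  choose d hd using hd
  have hne : Nonempty {f // τ.Adj f g} := by
    obtain ⟨x, hx⟩ := τ.vars_nonempty
    obtain ⟨f, -, hf⟩ := hflat.exists_query hx
    exact ⟨⟨f, hf⟩⟩
  obtain ⟨P, hP, hwin⟩ := hins
  let e := Fintype.equivFin (Shared priv → Bool)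
  let C : Frame τ g (Fintype.card (Shared priv → Bool)) :=
    { flat := hflat
      queries := (Finset.univ.filter fun f => τ.Adj f g).toList
      nodup := Finset.nodup_toList _
      mem_queries := by simp
      numUsers_pos := Fintype.card_pos }
  -- the replies of the first phase, which are the same for all linkings
  obtain ⟨r, hr⟩ := Frame.exists_replies (C := C) hP
    (phasedAt d e ⟨id, fun _ => 1, fun _ _ _ _ => rfl⟩)
  obtain ⟨L, hL⟩ := exists_linking (d := d) (r := fun f w => r f (e w)) (sharedInputs priv) hd
  obtain ⟨s, hs, i, hprint⟩ := hwin (C.global (phasedAt d e L))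
  obtain ⟨k, rfl⟩ := hs.exists_run
  obtain ⟨L', hrep, hdiff⟩ := hL (e.symm i)
  obtain ⟨s', hs', i', hprint'⟩ := hwin (C.global (phasedAt d e L'))
  obtain ⟨k', rfl⟩ := hs'.exists_run
  have hind : ∀ n, Frame.Indist C P (phasedAt d e L) (phasedAt d e L') n := by
    refine Frame.indist_of_replies hP (phasedAt_compatible hinj hpriv' e L L') rfl
      (hr _ (phasedAt_compatible hinj hpriv' e _ _)) (hr _ (phasedAt_compatible hinj hpriv' e _ _))
      fun f hf j => ?_
    have hsymm : ∀ L'' : Relinking {f // τ.Adj f g} (Shared priv) (sharedInputs priv),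
        ((phasedAt d e L'').user f).symm j = e (L''.inst ⟨f, hf⟩ (e.symm j)) := by
      intro L''
      rw [Equiv.symm_apply_eq]
      simp [phasedAt, hf]
    rw [hsymm, hsymm]
    exact (hrep ⟨f, hf⟩ (e.symm j)).symm
  have heq : sessionAt d L (e.symm i) = sessionAt d L' (e.symm i') :=
    toAssign_injective (Frame.print_unique hind hprint hprint')
  rcases hdiff (e.symm i') with h | ⟨f, h⟩
  · exact h (funext fun x => by
      rw [← sessionAt_shared (d := d), ← sessionAt_shared (d := d), heq])
  · exact h (by rw [← sessionAt_priv hinj, ← sessionAt_priv hinj, heq])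

end Protocol
end Linking

end

theorem theorem3 {N : Type*} [Finite N] (τ : Linking.Protocol N) (g : N) (hflat : τ.IsFlat g)
    (hpriv : ∀ f, τ.Adj f g → τ.HasPrivateVariable g f) :
    τ.Insecure ↔ ∃ T : Set N, τ.IsTrackingStrategy T :=
  ⟨fun h => hflat.exists_tracking hpriv h, fun ⟨_, hT⟩ => hflat.insecure_of_tracking hT⟩
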